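/- Let $K \ge 2$ and let $r^1, r^2, \ldots$ be independent random reward vectors in $\mathbb{R}^K$ with a common mean vector $\mu = (\mu_1,\ldots,\mu_K)$ (for instance i.i.d. vectors) that are sub-Gaussian: there are constants $B, \sigma > 0$ with $P(|r^t_j| > s) \le B e^{-\sigma^2 s^2}$ for all $s > 0$, all $t$ and all arms $j$. For a time horizon $T \ge 1$ and $\delta \in (0,1)$ put $$\gamma = 2\sqrt{\frac{3K\ln K}{5T}}, \qquad \alpha = 2\sqrt{\ln\frac{KT}{\delta}} .$$ When $\gamma < 1$, EXP3.P runs as follows. The initial weights are $w_i(1) = \exp\bigl(\frac{\alpha\gamma}{3}\sqrt{T/K}\bigr)$, $i = 1,\ldots,K$. In round $t = 1,\ldots,T$ it draws an arm $a_t$ from the distribution $p_i(t) = (1-\gamma)\frac{w_i(t)}{\sum_{j} w_j(t)} + \frac{\gamma}{K}$ (given the past, independently of $r^t$), receives $y_t = r^t_{a_t}$, and sets, for every arm $j$, $$\hat x_j(t) = \frac{r^t_j}{p_j(t)}\,\mathbf{1}_{j = a_t}, \qquad w_j(t+1) = w_j(t)\exp\Bigl(\frac{\gamma}{3K}\Bigl(\hat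 x_j(t) + \frac{\alpha}{p_j(t)\sqrt{KT}}\Bigr)\Bigr).$$ Let $R_T = \max_j \sum_{t=1}^T r^t_j - \sum_{t=1}^T y_t$ be the regret and $R'_T = T\max_k \mu_k - \sum_{t=1}^T E[y_t]$ the pseudo-regret. Write $f(T) = O^*(g(T))$ if $f(T) = O\bigl(g(T)(\log T)^k\bigr)$ as $T \to \infty$ for some $k \in \mathbb{N}$. Let $\delta = \delta_T \in (0,1)$ be constant or, more generally, depend on $T$ in such a way that $\log(1/\delta_T) = O^*(1)$ (for instance $\delta_T = 1/\sqrt{T}$ for $T \ge 2$). Then, for every $T \ge 1$ with $\gamma < 1$, the random variables $y_1, \ldots, y_T$ and $R_T$ are integrable and $$R'_T \le E[R_T],$$ and, as $T \to \infty$, $$E[R_T] = O^*(\sqrt{T}).$$ -/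

import Mathlib

open MeasureTheory ProbabilityTheory Filter Asymptotics

noncomputable section

/-- What happens in one round of a `K`-armed bandit: the vector of rewards of all arms, and the arm
that the player pulls. -/
abbrev Round (K : ℕ) : Type := (Fin K → ℝ) × Fin K

/-- The reward received by the player in a round. -/
def Round.gain {K : ℕ} (z : Round K) : ℝ := z.1 z.2

/-- `X` is sub-Gaussian with constants `B`, `σ`: `P(|X| > t) ≤ B exp(-σ² t²)` for every `t > 0`. -/
def HasSubGaussianTail {Ω : Type*} [MeasurableSpace Ω] (X : Ω → ℝ) (P : Measure Ω) (B σ : ℝ) :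
    Prop :=
  ∀ t : ℝ, 0 < t → P.real {ω | t < |X ω|} ≤ B * Real.exp (-(σ ^ 2 * t ^ 2))

/-- The laws `ν 0, ν 1, …` of the reward vectors of the successive rounds (which are independent of
each other) form a sub-Gaussian bandit with mean vector `μ`. -/
structure IsSubGaussianBandit {K : ℕ} (ν : ℕ → Measure (Fin K → ℝ)) (μ : Fin K → ℝ) : Prop where
  isProbabilityMeasure : ∀ t, IsProbabilityMeasure (ν t)
  subGaussian : ∃ B σ : ℝ, 0 < B ∧ 0 < σ ∧
    ∀ t j, HasSubGaussianTail (fun x : Fin K → ℝ => x j) (ν t) B σ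
  mean : ∀ t j, ∫ x, x j ∂(ν t) = μ j

namespace EXP3P

/-- The probabilities `p_i = (1 - γ) w_i / ∑ⱼ w_j + γ / K` computed from the weights `w`. -/
def prob {K : ℕ} (γ : ℝ) (w : Fin K → ℝ) (i : Fin K) : ℝ :=
  (1 - γ) * (w i / ∑ j, w j) + γ / K

/-- The reward estimates `x̂_j = (r_j / p_j) 𝟙{j = a}` after the round `z = (r, a)`. -/
def estimate {K : ℕ} (p : Fin K → ℝ) (z : Round K) (j : Fin K) : ℝ :=
  if j = z.2 then z.1 j / p j else 0

/-- The weights after `n` rounds with history `h`, when the algorithm is run with parameters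
`γ`, `α` and time horizon `T`. -/
def weight {K : ℕ} (γ α : ℝ) (T : ℕ) : (n : ℕ) → (Fin n → Round K) → Fin K → ℝ
  | 0, _, _ => Real.exp (α * γ / 3 * √(T / K))
  | n + 1, h, j =>
      let w : Fin K → ℝ := weight γ α T n (fun i => h i.castSucc)
      let p : Fin K → ℝ := prob γ w
      w j * Real.exp (γ / (3 * K) *
        (estimate p (h (Fin.last n)) j + α / (p j * √(K * T))))

lemma measurable_prob {K : ℕ} {Ω : Type*} [MeasurableSpace Ω] (γ : ℝ) {w : Ω → Fin K → ℝ}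
    (hw : ∀ j, Measurable fun x => w x j) (i : Fin K) : Measurable fun x => prob γ (w x) i := by
  unfold prob
  have : Measurable fun x => ∑ j, w x j := Finset.measurable_sum _ fun j _ => hw j
  have := hw i
  fun_prop

lemma measurable_weight {K : ℕ} (γ α : ℝ) (T n : ℕ) (j : Fin K) :
    Measurable fun h : Fin n → Round K => weight γ α T n h j := by
  induction n generalizing j with
  | zero => simp only [weight]; exact measurable_const
  | succ n ih =>
    simp only [weight, estimate]
    have hw : ∀ j, Measurable fun h : Fin (n + 1) → Round K =>
        weight γ α T n (fun i => h i.castSucc) j := fun j =>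
      (ih j).comp (measurable_pi_lambda _ fun i => measurable_pi_apply i.castSucc)
    have hp := measurable_prob γ hw j
    have hr : Measurable fun h : Fin (n + 1) → Round K => (h (Fin.last n)).1 j :=
      (measurable_pi_apply j).comp (measurable_fst.comp (measurable_pi_apply (Fin.last n)))
    have ha : MeasurableSet {h : Fin (n + 1) → Round K | j = (h (Fin.last n)).2} :=
      (measurable_snd.comp (measurable_pi_apply (Fin.last n)))
        (measurableSet_eq_fun measurable_const measurable_id : MeasurableSet {x : Fin K | j = x})
    refine (hw j).mul (Real.measurable_exp.comp (Measurable.const_mul (Measurable.add ?_ ?_) _))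
    · exact Measurable.ite ha (hr.div hp) measurable_const
    · exact measurable_const.div (hp.mul measurable_const)

/-- The conditional law of the next arm, given the history of the first `n` rounds: arm `i` is
chosen with probability `p_i`. -/
def armKernel (K : ℕ) (γ α : ℝ) (T n : ℕ) : Kernel (Fin n → Round K) (Fin K) where
  toFun h := ∑ i, ENNReal.ofReal (prob γ (weight γ α T n h) i) • Measure.dirac i
  measurable' := by
    refine Measure.measurable_of_measurable_coe _ fun s _ => ?_
    simp only [Measure.coe_finsetSum, Finset.sum_apply, Measure.smul_apply, smul_eq_mul]
    exact Finset.measurable_sum _ fun i _ =>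
      (measurable_prob γ (measurable_weight γ α T n) i).ennreal_ofReal.mul_const _

/-- The law of the first `n` rounds of the algorithm. Given the history `h`, the next reward
vector, with law `ν n`, and the next arm, with law `armKernel K γ α T n h`, are independent. -/
def law {K : ℕ} (ν : ℕ → Measure (Fin K → ℝ)) (γ α : ℝ) (T : ℕ) :
    (n : ℕ) → Measure (Fin n → Round K)
  | 0 => Measure.dirac Fin.elim0
  | n + 1 =>
      ((law ν γ α T n) ⊗ₘ ((Kernel.const _ (ν n)) ×ₖ (armKernel K γ α T n))).map
        (fun x => Fin.snoc (α := fun _ => Round K) x.1 x.2)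

/-- The parameter `γ = 2 √(3 K ln K / (5 T))`. -/
def gammaParam (K T : ℕ) : ℝ := 2 * √(3 * K * Real.log K / (5 * T))

/-- The parameter `α = 2 √(ln (K T / δ))`. -/
def alphaParam (K T : ℕ) (δ : ℝ) : ℝ := 2 * √(Real.log (K * T / δ))

/-- The law of all `T` rounds when the time horizon is `T` and the confidence parameter is `δ`. -/
def runLaw {K : ℕ} (ν : ℕ → Measure (Fin K → ℝ)) (T : ℕ) (δ : ℝ) : Measure (Fin T → Round K) :=
  law ν (gammaParam K T) (alphaParam K T δ) T T

end EXP3P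

/-- The regret `R_T = max_j ∑_t r^t_j - ∑_t y_t` of a run of `T` rounds. -/
def regret {K T : ℕ} (h : Fin T → Round K) : ℝ :=
  (⨆ j : Fin K, ∑ t, (h t).1 j) - ∑ t, (h t).gain

/-- The expected regret `E[R_T]`, for runs distributed according to `P`. -/
def expectedRegret {K T : ℕ} (P : Measure (Fin T → Round K)) : ℝ := ∫ h, regret h ∂P

/-- The pseudo-regret `R'_T = T max_k μ_k - ∑_t E[y_t]`, for runs distributed according to `P`. -/
def pseudoRegret {K T : ℕ} (μ : Fin K → ℝ) (P : Measure (Fin T → Round K)) : ℝ :=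
  T * (⨆ k : Fin K, μ k) - ∑ t, ∫ h, (h t).gain ∂P

/-- `f = O*(g)`: big O up to a power of `log T`. -/
def IsBigOStar (f g : ℕ → ℝ) : Prop :=
  ∃ k : ℕ, f =O[atTop] fun T => Real.log T ^ k * g T

end

/-! ### Moments of sub-Gaussian variables -/

/-! No high-probability analysis is needed: the usual exponential-weights argument is run in
expectation, with a moment bound in place of bounded rewards.

Write `η = γ / (3K)`, `q` for the normalised weights, `p` for the sampling probabilities and `b = α
/ √(KT)`. Since `p ≥ γ / K`, one has `η / p ≤ 1 / 3`, so the exponent of a weight update is at most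
`1 + |r| / 3` in absolute value once `b ≤ 3`. The inequality `e^x ≤ 1 + x + x² e^|x|`, valid for all
real `x`, then replaces the one for bounded rewards, and its remainder is controlled by `momentFun`,
whose mean is bounded by a constant `M` because the tails are sub-Gaussian.

The potential is the logarithm of the total weight minus `η` times the accumulated gain. In one
round its mean grows by at most `roundError`: the first-order part has mean `η ∑ (q - p) μ`, where
`q - p = γ (q - 1/K)` is small, and the rest is controlled by `q / p ≤ 1 / (1 - γ)` and `p ≥ γ / K`
(`log_sum_update_le`, `expected_growth_le`, `exists_potential_bound`). On the other side, the total
weight dominates the weight of a best arm, and the mean of the logarithm of that weight grows by at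
least `η μ_k` per round, since importance weighting is unbiased and the bonus is nonnegative
(`log_weight_lower_bound`). Comparing the two gives `pseudoRegret_le`, which for `γ` of order `1 /
√T` is of order `√T (1 + α²)`.

The expected regret exceeds the pseudo-regret only through fluctuations of the `K` reward sums,
whose variances are at most linear, hence by `O(√T)`. It is nonnegative because the pseudo-regret
is, so its absolute value is controlled. Finally `δ` enters only through `α²`, which is
polylogarithmic. -/

/-- An exponential moment that controls everything the regret analysis needs. -/
noncomputable def momentFun (x : ℝ) : ℝ := (x ^ 2 + 1) * Real.exp (|x| / 3)

lemma measurable_momentFun : Measurable momentFun := by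
  unfold momentFun
  fun_prop

lemma momentFun_nonneg (x : ℝ) : 0 ≤ momentFun x := by
  unfold momentFun
  positivity

lemma sq_add_one_le_momentFun (x : ℝ) : x ^ 2 + 1 ≤ momentFun x :=
  le_mul_of_one_le_right (by positivity) (Real.one_le_exp (by positivity))

lemma abs_le_momentFun (x : ℝ) : |x| ≤ momentFun x := by
  refine le_trans ?_ (sq_add_one_le_momentFun x)
  nlinarith [sq_nonneg (|x| - 1), sq_abs x]

/-- Combine `x² + 1 ≤ 2 e^|x|` with the AM-GM bound `2|x| ≤ 2/σ² + σ²x²/2`: the total exponent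
`4|x|/3` is absorbed by half of the Gaussian rate. -/
lemma momentFun_le (x : ℝ) {σ : ℝ} (hσ : 0 < σ) :
    momentFun x ≤ 2 * Real.exp (2 / σ ^ 2) * Real.exp (σ ^ 2 * x ^ 2 / 2) := by
  have h1 : x ^ 2 + 1 ≤ 2 * Real.exp |x| := by
    have := Real.quadratic_le_exp_of_nonneg (abs_nonneg x)
    have h2 := sq_abs x
    have := abs_nonneg x
    linarith
  have h2 : |x| + |x| / 3 ≤ 2 / σ ^ 2 + σ ^ 2 * x ^ 2 / 2 := by
    have h3 : 2 * |x| ≤ 2 / σ ^ 2 + σ ^ 2 * x ^ 2 / 2 := by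
      have : 2 / σ ^ 2 + σ ^ 2 * x ^ 2 / 2 - 2 * |x| = (2 / σ - σ * |x|) ^ 2 / 2 := by
        rw [← sq_abs x]
        field_simp
        ring
      have := sq_nonneg (2 / σ - σ * |x|)
      linarith
    have := abs_nonneg x
    linarith
  calc momentFun x ≤ (2 * Real.exp |x|) * Real.exp (|x| / 3) := by
        unfold momentFun
        gcongr
    _ = 2 * Real.exp (|x| + |x| / 3) := by rw [Real.exp_add]; ring
    _ ≤ 2 * Real.exp (2 / σ ^ 2 + σ ^ 2 * x ^ 2 / 2) := by gcongr
    _ = _ := by rw [Real.exp_add]; ring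

/-- Layer-cake formula. Levels below `1` contribute at most `1`. For `s > 1` the tail at `√(2 log s)
/ σ` gives probability at most `B s⁻²`, whose integral over `(1, ∞)` is `B`; halving the exponent is
what makes this power integrable. -/
lemma HasSubGaussianTail.lintegral_exp_sq_le {Ω : Type*} [MeasurableSpace Ω] {X : Ω → ℝ}
    {P : Measure Ω} [IsProbabilityMeasure P] {B σ : ℝ} (hB : 0 < B) (hσ : 0 < σ)
    (hX : Measurable X) (h : HasSubGaussianTail X P B σ) :
    ∫⁻ ω, ENNReal.ofReal (Real.exp (σ ^ 2 * X ω ^ 2 / 2)) ∂P ≤ ENNReal.ofReal (1 + B) := by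
  rw [lintegral_eq_lintegral_meas_lt P (Eventually.of_forall fun _ => (Real.exp_pos _).le)
    (by fun_prop), ← Set.Ioc_union_Ioi_eq_Ioi zero_le_one,
    lintegral_union measurableSet_Ioi (Set.Ioc_disjoint_Ioi le_rfl),
    ENNReal.ofReal_add zero_le_one hB.le]
  refine add_le_add ?_ ?_
  · calc _ ≤ ∫⁻ _ in Set.Ioc (0 : ℝ) 1, 1 := lintegral_mono fun _ => prob_le_one
      _ = _ := by simp
  · have hint : IntegrableOn (fun s : ℝ => B * s ^ (-2 : ℝ)) (Set.Ioi 1) :=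
      (integrableOn_Ioi_rpow_of_lt (by norm_num) one_pos).const_mul _
    have hval : ∫ s in Set.Ioi (1 : ℝ), B * s ^ (-2 : ℝ) = B := by
      rw [integral_const_mul, integral_Ioi_rpow_of_lt (by norm_num) one_pos]
      norm_num
    calc _ ≤ ∫⁻ s in Set.Ioi (1 : ℝ), ENNReal.ofReal (B * s ^ (-2 : ℝ)) := by
          refine setLIntegral_mono' measurableSet_Ioi fun s hs => ?_
          have hs' : (1 : ℝ) < s := hs
          have hlog : 0 < Real.log s := Real.log_pos hs'
          have hu : 0 < √(2 * Real.log s) / σ := by positivity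
          have hu2 : σ ^ 2 * (√(2 * Real.log s) / σ) ^ 2 = 2 * Real.log s := by
            rw [div_pow, Real.sq_sqrt (by positivity)]
            field_simp
          have htail := h _ hu
          rw [hu2] at htail
          have hsub : {ω | s < Real.exp (σ ^ 2 * X ω ^ 2 / 2)} ⊆
              {ω | √(2 * Real.log s) / σ < |X ω|} := by
            intro ω hω
            have h1 : Real.log s < σ ^ 2 * X ω ^ 2 / 2 :=
              (Real.log_lt_iff_lt_exp (by linarith)).2 hω
            refine lt_of_pow_lt_pow_left₀ 2 (abs_nonneg (X ω)) ?_
            rw [sq_abs]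
            have : 0 < σ ^ 2 := by positivity
            nlinarith
          calc P {ω | s < Real.exp (σ ^ 2 * X ω ^ 2 / 2)}
              ≤ P {ω | √(2 * Real.log s) / σ < |X ω|} := measure_mono hsub
            _ = ENNReal.ofReal (P.real {ω | √(2 * Real.log s) / σ < |X ω|}) := by simp
            _ ≤ _ := by
              refine ENNReal.ofReal_le_ofReal (htail.trans_eq ?_)
              rw [Real.rpow_def_of_pos (by linarith)]
              ring_nf
      _ = ENNReal.ofReal B := by
          rw [← ofReal_integral_eq_lintegral_ofReal hint, hval]
          filter_upwards [ae_restrict_mem measurableSet_Ioi] with s hs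
          have : (0 : ℝ) < s := zero_lt_one.trans hs
          positivity

lemma HasSubGaussianTail.lintegral_momentFun_le {Ω : Type*} [MeasurableSpace Ω] {X : Ω → ℝ}
    {P : Measure Ω} [IsProbabilityMeasure P] {B σ : ℝ} (hB : 0 < B) (hσ : 0 < σ)
    (hX : Measurable X) (h : HasSubGaussianTail X P B σ) :
    ∫⁻ ω, ENNReal.ofReal (momentFun (X ω)) ∂P ≤
      ENNReal.ofReal (2 * Real.exp (2 / σ ^ 2) * (1 + B)) := by
  calc _ ≤ ∫⁻ ω, ENNReal.ofReal (2 * Real.exp (2 / σ ^ 2)) *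
        ENNReal.ofReal (Real.exp (σ ^ 2 * X ω ^ 2 / 2)) ∂P := by
        refine lintegral_mono fun ω => ?_
        rw [← ENNReal.ofReal_mul (by positivity)]
        exact ENNReal.ofReal_le_ofReal (momentFun_le _ hσ)
    _ = ENNReal.ofReal (2 * Real.exp (2 / σ ^ 2)) *
        ∫⁻ ω, ENNReal.ofReal (Real.exp (σ ^ 2 * X ω ^ 2 / 2)) ∂P :=
        lintegral_const_mul' _ _ ENNReal.ofReal_ne_top
    _ ≤ _ := by
        rw [ENNReal.ofReal_mul (q := 1 + B) (by positivity)]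
        exact mul_le_mul_right (h.lintegral_exp_sq_le hB hσ hX) _

/-- The rewards of the bandit have moments bounded by `M`, uniformly in time and over the arms. -/
structure HasMomentBound {K : ℕ} (ν : ℕ → Measure (Fin K → ℝ)) (μ : Fin K → ℝ) (M : ℝ) :
    Prop where
  isProbabilityMeasure : ∀ t, IsProbabilityMeasure (ν t)
  integrable : ∀ t j, Integrable (fun x => momentFun (x j)) (ν t)
  integral_le : ∀ t j, ∫ x, momentFun (x j) ∂(ν t) ≤ M
  mean : ∀ t j, ∫ x, x j ∂(ν t) = μ j

lemma IsSubGaussianBandit.exists_momentBound {K : ℕ} {ν : ℕ → Measure (Fin K → ℝ)}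
    {μ : Fin K → ℝ} (hν : IsSubGaussianBandit ν μ) : ∃ M, 0 < M ∧ HasMomentBound ν μ M := by
  obtain ⟨B, σ, hB, hσ, h⟩ := hν.subGaussian
  have hM : 0 < 2 * Real.exp (2 / σ ^ 2) * (1 + B) := by positivity
  refine ⟨2 * Real.exp (2 / σ ^ 2) * (1 + B), hM, hν.isProbabilityMeasure, ?_, ?_, hν.mean⟩
  · intro t j
    have := hν.isProbabilityMeasure t
    refine ⟨(measurable_momentFun.comp (measurable_pi_apply j)).aestronglyMeasurable, ?_⟩
    rw [hasFiniteIntegral_iff_ofReal (Eventually.of_forall fun _ => momentFun_nonneg _)]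
    exact ((h t j).lintegral_momentFun_le hB hσ (measurable_pi_apply j)).trans_lt
      ENNReal.ofReal_lt_top
  · intro t j
    have := hν.isProbabilityMeasure t
    rw [integral_eq_lintegral_of_nonneg_ae (Eventually.of_forall fun _ => momentFun_nonneg _)
      (measurable_momentFun.comp (measurable_pi_apply j)).aestronglyMeasurable]
    exact ENNReal.toReal_le_of_le_ofReal hM.le
      ((h t j).lintegral_momentFun_le hB hσ (measurable_pi_apply j))

namespace HasMomentBound

variable {K : ℕ} {ν : ℕ → Measure (Fin K → ℝ)} {μ : Fin K → ℝ} {M : ℝ}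

lemma integrable_reward (h : HasMomentBound ν μ M) (t : ℕ) (j : Fin K) :
    Integrable (fun x => x j) (ν t) :=
  (h.integrable t j).mono' (measurable_pi_apply j).aestronglyMeasurable
    (Eventually.of_forall fun x => abs_le_momentFun (x j))

lemma integrable_reward_sq (h : HasMomentBound ν μ M) (t : ℕ) (j : Fin K) :
    Integrable (fun x => x j ^ 2) (ν t) := by
  refine (h.integrable t j).mono' ((measurable_pi_apply j).pow_const 2).aestronglyMeasurable
    (Eventually.of_forall fun x => ?_)
  rw [Real.norm_of_nonneg (sq_nonneg _)]
  linarith [sq_add_one_le_momentFun (x j)]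

lemma abs_mean_le (h : HasMomentBound ν μ M) (j : Fin K) : |μ j| ≤ M := by
  rw [← h.mean 0 j]
  exact (abs_integral_le_integral_abs).trans ((integral_mono (h.integrable_reward 0 j).abs
    (h.integrable 0 j) fun x => abs_le_momentFun (x j)).trans (h.integral_le 0 j))

lemma integrable_centered_sq (h : HasMomentBound ν μ M) (t : ℕ) (j : Fin K) :
    Integrable (fun x => (x j - μ j) ^ 2) (ν t) := by
  have := h.isProbabilityMeasure t
  have e : (fun x : Fin K → ℝ => (x j - μ j) ^ 2) =
      fun x => x j ^ 2 - 2 * μ j * x j + μ j ^ 2 := by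
    ext x; ring
  rw [e]
  exact ((h.integrable_reward_sq t j).sub ((h.integrable_reward t j).const_mul _)).add
    (integrable_const _)

lemma integral_centered (h : HasMomentBound ν μ M) (t : ℕ) (j : Fin K) :
    ∫ x, (x j - μ j) ∂(ν t) = 0 := by
  have := h.isProbabilityMeasure t
  rw [integral_sub (h.integrable_reward t j) (integrable_const _), h.mean]
  simp

lemma integral_centered_sq_le (h : HasMomentBound ν μ M) (t : ℕ) (j : Fin K) :
    ∫ x, (x j - μ j) ^ 2 ∂(ν t) ≤ M := by
  have := h.isProbabilityMeasure t
  have e : ∀ x : Fin K → ℝ, (x j - μ j) ^ 2 = x j ^ 2 - (2 * μ j * (x j - μ j) + μ j ^ 2) := by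
    intro x; ring
  have hc : Integrable (fun x => x j - μ j) (ν t) :=
    (h.integrable_reward t j).sub (integrable_const _)
  have h2 : ∫ x, (x j - μ j) ^ 2 ∂(ν t) = ∫ x, x j ^ 2 ∂(ν t) - μ j ^ 2 := by
    simp_rw [e]
    rw [integral_sub (h.integrable_reward_sq t j) ((hc.const_mul _).fun_add (integrable_const _)),
      integral_add (hc.const_mul _) (integrable_const _), integral_const_mul,
      h.integral_centered]
    simp
  have h3 : ∫ x, x j ^ 2 ∂(ν t) ≤ M :=
    (integral_mono (h.integrable_reward_sq t j) (h.integrable t j) fun x => by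
      linarith [sq_add_one_le_momentFun (x j)]).trans (h.integral_le t j)
  nlinarith [sq_nonneg (μ j)]

end HasMomentBound

namespace EXP3P

/-! ### The weights and the probabilities -/

lemma weight_pos {K : ℕ} (γ α : ℝ) (T n : ℕ) (h : Fin n → Round K) (j : Fin K) :
    0 < weight γ α T n h j := by
  induction n generalizing j with
  | zero => exact Real.exp_pos _
  | succ n ih =>
    simp only [weight]
    exact mul_pos (ih _ _) (Real.exp_pos _)

lemma gamma_div_le_prob {K : ℕ} {γ : ℝ} (hγ : γ ≤ 1) {w : Fin K → ℝ} (hw : ∀ j, 0 < w j)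
    (i : Fin K) : γ / K ≤ prob γ w i := by
  unfold prob
  have : 0 ≤ w i / ∑ j, w j := div_nonneg (hw i).le (Finset.sum_nonneg fun j _ => (hw j).le)
  nlinarith

lemma prob_nonneg {K : ℕ} {γ : ℝ} (h0 : 0 ≤ γ) (h1 : γ ≤ 1) {w : Fin K → ℝ} (hw : ∀ j, 0 < w j)
    (i : Fin K) : 0 ≤ prob γ w i :=
  le_trans (by positivity) (gamma_div_le_prob h1 hw i)

lemma sum_div_sum_eq_one {K : ℕ} [NeZero K] {w : Fin K → ℝ} (hw : ∀ j, 0 < w j) :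
    ∑ i, w i / ∑ j, w j = 1 := by
  rw [← Finset.sum_div, div_self (Finset.sum_pos (fun j _ => hw j) Finset.univ_nonempty).ne']

lemma sum_prob {K : ℕ} [NeZero K] (γ : ℝ) {w : Fin K → ℝ} (hw : ∀ j, 0 < w j) :
    ∑ i, prob γ w i = 1 := by
  have : (K : ℝ) ≠ 0 := NeZero.ne _
  simp only [prob]
  rw [Finset.sum_add_distrib, ← Finset.mul_sum, sum_div_sum_eq_one hw]
  simp
  field_simp
  ring

lemma prob_le_one {K : ℕ} [NeZero K] {γ : ℝ} (h0 : 0 ≤ γ) (h1 : γ ≤ 1) {w : Fin K → ℝ}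
    (hw : ∀ j, 0 < w j) (i : Fin K) : prob γ w i ≤ 1 := by
  rw [← sum_prob γ hw]
  exact Finset.single_le_sum (fun j _ => prob_nonneg h0 h1 hw j) (Finset.mem_univ i)

/-! ### The law of a run -/

lemma armKernel_apply {K : ℕ} (γ α : ℝ) (T n : ℕ) (h : Fin n → Round K) :
    armKernel K γ α T n h =
      ∑ i, ENNReal.ofReal (prob γ (weight γ α T n h) i) • Measure.dirac i := rfl

lemma isMarkovKernel_armKernel {K : ℕ} [NeZero K] {γ : ℝ} (h0 : 0 ≤ γ) (h1 : γ ≤ 1) (α : ℝ)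
    (T n : ℕ) : IsMarkovKernel (armKernel K γ α T n) := by
  refine ⟨fun h => ⟨?_⟩⟩
  rw [armKernel_apply]
  simp only [Measure.coe_finsetSum, Finset.sum_apply, Measure.smul_apply, smul_eq_mul,
    measure_univ, mul_one]
  rw [← ENNReal.ofReal_sum_of_nonneg fun i _ => prob_nonneg h0 h1 (weight_pos γ α T n h) i,
    sum_prob γ (weight_pos γ α T n h), ENNReal.ofReal_one]

lemma integral_armKernel {K : ℕ} {γ : ℝ} (h0 : 0 ≤ γ) (h1 : γ ≤ 1) (α : ℝ)
    (T n : ℕ) (h : Fin n → Round K) (u : Fin K → ℝ) :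
    ∫ a, u a ∂(armKernel K γ α T n h) = ∑ i, prob γ (weight γ α T n h) i * u i := by
  rw [armKernel_apply, integral_finsetSum_measure]
  · refine Finset.sum_congr rfl fun i _ => ?_
    rw [integral_smul_measure, integral_dirac,
      ENNReal.toReal_ofReal (prob_nonneg h0 h1 (weight_pos γ α T n h) i), smul_eq_mul]
  · intro i _
    exact (integrable_dirac (by simp)).smul_measure ENNReal.ofReal_ne_top

lemma measurable_snoc {K n : ℕ} : Measurable fun x : (Fin n → Round K) × Round K =>
    (Fin.snoc (α := fun _ => Round K) x.1 x.2 : Fin (n + 1) → Round K) := by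
  refine measurable_pi_iff.2 fun i => ?_
  induction i using Fin.lastCases with
  | last => simpa using measurable_snd
  | cast i =>
    simp only [Fin.snoc_castSucc]
    exact (measurable_pi_apply i).comp measurable_fst

lemma measurable_init {K n : ℕ} :
    Measurable fun h : Fin (n + 1) → Round K => fun i : Fin n => h i.castSucc :=
  measurable_pi_lambda _ fun i => measurable_pi_apply i.castSucc

section law

variable {K : ℕ} [NeZero K] {ν : ℕ → Measure (Fin K → ℝ)} {γ : ℝ}

lemma isProbabilityMeasure_law (hν : ∀ t, IsProbabilityMeasure (ν t)) (h0 : 0 ≤ γ) (h1 : γ ≤ 1)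
    (α : ℝ) (T n : ℕ) : IsProbabilityMeasure (law ν γ α T n) := by
  induction n with
  | zero => rw [law]; infer_instance
  | succ n ih =>
    have := isMarkovKernel_armKernel (K := K) h0 h1 α T n
    rw [law]
    exact Measure.isProbabilityMeasure_map measurable_snoc.aemeasurable

/-- The history and the next reward vector are independent. -/
lemma map_init_reward_law (hν : ∀ t, IsProbabilityMeasure (ν t)) (h0 : 0 ≤ γ) (h1 : γ ≤ 1)
    (α : ℝ) (T n : ℕ) :
    (law ν γ α T (n + 1)).map (fun h => ((fun i : Fin n => h i.castSucc), (h (Fin.last n)).1)) =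
      (law ν γ α T n).prod (ν n) := by
  have := isMarkovKernel_armKernel (K := K) h0 h1 α T n
  have := isProbabilityMeasure_law hν h0 h1 α T n
  rw [law, Measure.map_map (by have := measurable_init (K := K) (n := n); fun_prop)
    measurable_snoc]
  have e : (fun h : Fin (n + 1) → Round K =>
      ((fun i : Fin n => h i.castSucc), (h (Fin.last n)).1)) ∘
      (fun x : (Fin n → Round K) × Round K => Fin.snoc (α := fun _ => Round K) x.1 x.2) =
      Prod.map id Prod.fst := by
    ext x <;> simp
  rw [e, ← Measure.compProd_map measurable_fst, ← Kernel.fst_eq, Kernel.fst_prod,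
    Measure.compProd_const]

/-- Functions of the history, of the next reward vector and of the next arm. -/
lemma integrable_law_succ (hν : ∀ t, IsProbabilityMeasure (ν t)) (h0 : 0 ≤ γ) (h1 : γ ≤ 1)
    (α : ℝ) (T n : ℕ) {c : (Fin n → Round K) → ℝ} (hc : Integrable c (law ν γ α T n))
    {f : (Fin K → ℝ) → ℝ} (hf : Integrable f (ν n)) (u : Fin K → ℝ) :
    Integrable (fun h : Fin (n + 1) → Round K =>
      c (fun i => h i.castSucc) * f (h (Fin.last n)).1 * u (h (Fin.last n)).2)
      (law ν γ α T (n + 1)) := by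
  have := isProbabilityMeasure_law hν h0 h1 α T n
  have hcf : Integrable (fun h : Fin (n + 1) → Round K =>
      c (fun i => h i.castSucc) * f (h (Fin.last n)).1) (law ν γ α T (n + 1)) := by
    have := hc.mul_prod hf
    rw [← map_init_reward_law hν h0 h1] at this
    exact this.comp_measurable (by have := measurable_init (K := K) (n := n); fun_prop)
  refine hcf.mul_bdd (c := ∑ j, |u j|) ?_ ?_
  · exact ((measurable_of_finite u).comp
      (measurable_snd.comp (measurable_pi_apply (Fin.last n)))).aestronglyMeasurable
  · exact Eventually.of_forall fun h => Finset.single_le_sum (f := fun j => |u j|)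
      (fun j _ => abs_nonneg _) (Finset.mem_univ _)

/-- Given the history, the reward vector and the arm are independent, and the law of the rewards
ignores the history, so the reward integral factors out. Later expectations over one more round
reduce to this product form; constant choices of `f` or `u` give the marginal versions below. -/
lemma integral_law_succ (hν : ∀ t, IsProbabilityMeasure (ν t)) (h0 : 0 ≤ γ) (h1 : γ ≤ 1)
    (α : ℝ) (T n : ℕ) {c : (Fin n → Round K) → ℝ} (hc : Integrable c (law ν γ α T n))
    {f : (Fin K → ℝ) → ℝ} (hf : Integrable f (ν n)) (u : Fin K → ℝ) :
    ∫ h, c (fun i => h i.castSucc) * f (h (Fin.last n)).1 * u (h (Fin.last n)).2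
      ∂(law ν γ α T (n + 1)) =
    (∫ h, c h * ∑ i, prob γ (weight γ α T n h) i * u i ∂(law ν γ α T n)) * ∫ x, f x ∂(ν n) := by
  have := isMarkovKernel_armKernel (K := K) h0 h1 α T n
  have := isProbabilityMeasure_law hν h0 h1 α T n
  have hi := integrable_law_succ hν h0 h1 α T n hc hf u
  rw [law] at hi ⊢
  rw [integral_map measurable_snoc.aemeasurable hi.aestronglyMeasurable]
  have hi' := (integrable_map_measure hi.aestronglyMeasurable measurable_snoc.aemeasurable).1 hi
  rw [← integral_mul_const]
  refine (Measure.integral_compProd hi').trans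
    (integral_congr_ae (Eventually.of_forall fun h => ?_))
  simp only [Function.comp_apply, Fin.snoc_castSucc, Fin.snoc_last, Kernel.prod_apply,
    Kernel.const_apply]
  rw [integral_prod_mul (fun x => c h * f x) u, integral_const_mul, integral_armKernel h0 h1]
  ring

lemma integrable_comp_init (hν : ∀ t, IsProbabilityMeasure (ν t)) (h0 : 0 ≤ γ) (h1 : γ ≤ 1)
    (α : ℝ) (T n : ℕ) {c : (Fin n → Round K) → ℝ} (hc : Integrable c (law ν γ α T n)) :
    Integrable (fun h : Fin (n + 1) → Round K => c fun i => h i.castSucc)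
      (law ν γ α T (n + 1)) := by
  simpa using integrable_law_succ hν h0 h1 α T n hc (integrable_const (1 : ℝ)) (fun _ => 1)

lemma integral_comp_init (hν : ∀ t, IsProbabilityMeasure (ν t)) (h0 : 0 ≤ γ) (h1 : γ ≤ 1)
    (α : ℝ) (T n : ℕ) {c : (Fin n → Round K) → ℝ} (hc : Integrable c (law ν γ α T n)) :
    ∫ h, c (fun i => h i.castSucc) ∂(law ν γ α T (n + 1)) = ∫ h, c h ∂(law ν γ α T n) := by
  simpa [sum_prob γ (weight_pos γ α T n _)] using
    integral_law_succ hν h0 h1 α T n hc (integrable_const (1 : ℝ)) (fun _ => 1)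

lemma integrable_mul_reward (hν : ∀ t, IsProbabilityMeasure (ν t)) (h0 : 0 ≤ γ) (h1 : γ ≤ 1)
    (α : ℝ) (T n : ℕ) {c : (Fin n → Round K) → ℝ} (hc : Integrable c (law ν γ α T n))
    {f : (Fin K → ℝ) → ℝ} (hf : Integrable f (ν n)) :
    Integrable (fun h : Fin (n + 1) → Round K =>
      c (fun i => h i.castSucc) * f (h (Fin.last n)).1) (law ν γ α T (n + 1)) := by
  simpa using integrable_law_succ hν h0 h1 α T n hc hf (fun _ => 1)

lemma integral_mul_reward (hν : ∀ t, IsProbabilityMeasure (ν t)) (h0 : 0 ≤ γ) (h1 : γ ≤ 1)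
    (α : ℝ) (T n : ℕ) {c : (Fin n → Round K) → ℝ} (hc : Integrable c (law ν γ α T n))
    {f : (Fin K → ℝ) → ℝ} (hf : Integrable f (ν n)) :
    ∫ h, c (fun i => h i.castSucc) * f (h (Fin.last n)).1 ∂(law ν γ α T (n + 1)) =
      (∫ h, c h ∂(law ν γ α T n)) * ∫ x, f x ∂(ν n) := by
  simpa [sum_prob γ (weight_pos γ α T n _)] using
    integral_law_succ hν h0 h1 α T n hc hf (fun _ => 1)

lemma integrable_reward (hν : ∀ t, IsProbabilityMeasure (ν t)) (h0 : 0 ≤ γ) (h1 : γ ≤ 1)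
    (α : ℝ) (T n : ℕ) (t : Fin n) {f : (Fin K → ℝ) → ℝ} (hf : Integrable f (ν t)) :
    Integrable (fun h : Fin n → Round K => f (h t).1) (law ν γ α T n) := by
  induction n with
  | zero => exact t.elim0
  | succ n ih =>
    have := isProbabilityMeasure_law hν h0 h1 α T n
    induction t using Fin.lastCases with
    | last => simpa using integrable_mul_reward hν h0 h1 α T n (integrable_const (1 : ℝ)) hf
    | cast t => exact integrable_comp_init hν h0 h1 α T n (ih t hf)

lemma integral_reward (hν : ∀ t, IsProbabilityMeasure (ν t)) (h0 : 0 ≤ γ) (h1 : γ ≤ 1)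
    (α : ℝ) (T n : ℕ) (t : Fin n) {f : (Fin K → ℝ) → ℝ} (hf : Integrable f (ν t)) :
    ∫ h, f (h t).1 ∂(law ν γ α T n) = ∫ x, f x ∂(ν t) := by
  induction n with
  | zero => exact t.elim0
  | succ n ih =>
    have := isProbabilityMeasure_law hν h0 h1 α T n
    induction t using Fin.lastCases with
    | last => simpa using integral_mul_reward hν h0 h1 α T n (integrable_const (1 : ℝ)) hf
    | cast t =>
      exact (integral_comp_init hν h0 h1 α T n
        (integrable_reward hν h0 h1 α T n t hf)).trans (ih t hf)

end law

/-! ### Gains and regrets -/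

/-- Writes the gain as a sum of products of a reward factor and an arm factor, the form handled by
`integral_law_succ`. -/
lemma gain_eq_sum {K : ℕ} (z : Round K) : z.gain = ∑ j, z.1 j * if j = z.2 then 1 else 0 := by
  simp [Round.gain]

section moments

variable {K : ℕ} [NeZero K] {ν : ℕ → Measure (Fin K → ℝ)} {μ : Fin K → ℝ} {M γ : ℝ}

lemma integrable_gain (hν : HasMomentBound ν μ M) (h0 : 0 ≤ γ) (h1 : γ ≤ 1) (α : ℝ) (T n : ℕ)
    (t : Fin n) : Integrable (fun h : Fin n → Round K => (h t).gain) (law ν γ α T n) := by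
  simp_rw [gain_eq_sum]
  refine integrable_finsetSum _ fun j _ => ?_
  refine (integrable_reward hν.isProbabilityMeasure h0 h1 α T n t
    (hν.integrable_reward t j)).mul_bdd (c := 1) ?_ ?_
  · exact ((measurable_of_finite fun a : Fin K => if j = a then (1 : ℝ) else 0).comp
      (measurable_snd.comp (measurable_pi_apply t))).aestronglyMeasurable
  · refine Eventually.of_forall fun h => ?_
    split_ifs <;> simp

lemma integrable_sum_reward (hν : HasMomentBound ν μ M) (h0 : 0 ≤ γ) (h1 : γ ≤ 1) (α : ℝ)
    (T n : ℕ) (j : Fin K) :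
    Integrable (fun h : Fin n → Round K => ∑ t, (h t).1 j) (law ν γ α T n) :=
  integrable_finsetSum _ fun t _ =>
    integrable_reward hν.isProbabilityMeasure h0 h1 α T n t (hν.integrable_reward t j)

lemma integral_sum_reward (hν : HasMomentBound ν μ M) (h0 : 0 ≤ γ) (h1 : γ ≤ 1) (α : ℝ)
    (T n : ℕ) (j : Fin K) :
    ∫ h, ∑ t, (h t).1 j ∂(law ν γ α T n) = n * μ j := by
  rw [integral_finsetSum _ fun t _ =>
    integrable_reward hν.isProbabilityMeasure h0 h1 α T n t (hν.integrable_reward t j)]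
  simp_rw [fun t : Fin n => integral_reward hν.isProbabilityMeasure h0 h1 α T n t
    (hν.integrable_reward t j), hν.mean]
  simp

lemma integrable_iSup_sum_reward (hν : HasMomentBound ν μ M) (h0 : 0 ≤ γ) (h1 : γ ≤ 1) (α : ℝ)
    (T n : ℕ) :
    Integrable (fun h : Fin n → Round K => ⨆ j, ∑ t, (h t).1 j) (law ν γ α T n) := by
  refine (integrable_finsetSum Finset.univ fun j _ =>
    (integrable_sum_reward hν h0 h1 α T n j).abs).mono' ?_ (Eventually.of_forall fun h => ?_)
  · refine (Measurable.iSup fun j => Finset.measurable_sum _ fun t _ => ?_).aestronglyMeasurable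
    exact (measurable_pi_apply j).comp (measurable_fst.comp (measurable_pi_apply t))
  · obtain ⟨j, hj⟩ := exists_eq_ciSup_of_finite (f := fun j => ∑ t, (h t).1 j)
    rw [← hj]
    exact Finset.single_le_sum (f := fun j => |∑ t, (h t).1 j|)
      (fun j _ => abs_nonneg _) (Finset.mem_univ j)

lemma integrable_regret (hν : HasMomentBound ν μ M) (h0 : 0 ≤ γ) (h1 : γ ≤ 1) (α : ℝ)
    (T n : ℕ) : Integrable regret (law ν γ α T n) :=
  (integrable_iSup_sum_reward hν h0 h1 α T n).sub
    (integrable_finsetSum _ fun t _ => integrable_gain hν h0 h1 α T n t)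

lemma expectedRegret_eq (hν : HasMomentBound ν μ M) (h0 : 0 ≤ γ) (h1 : γ ≤ 1) (α : ℝ)
    (T n : ℕ) : expectedRegret (law ν γ α T n) =
      ∫ h, ⨆ j, ∑ t, (h t).1 j ∂(law ν γ α T n) - ∑ t, ∫ h, (h t).gain ∂(law ν γ α T n) := by
  unfold expectedRegret regret
  rw [integral_sub (integrable_iSup_sum_reward hν h0 h1 α T n)
    (integrable_finsetSum _ fun t _ => integrable_gain hν h0 h1 α T n t),
    integral_finsetSum _ fun t _ => integrable_gain hν h0 h1 α T n t]

/-! ### Comparison of the expected regret with the pseudo-regret -/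

lemma pseudoRegret_le_expectedRegret (hν : HasMomentBound ν μ M) (h0 : 0 ≤ γ) (h1 : γ ≤ 1)
    (α : ℝ) (T n : ℕ) :
    pseudoRegret μ (law ν γ α T n) ≤ expectedRegret (law ν γ α T n) := by
  rw [expectedRegret_eq hν h0 h1, pseudoRegret]
  refine sub_le_sub_right ?_ _
  obtain ⟨k, hk⟩ := exists_eq_ciSup_of_finite (f := μ)
  rw [← hk, ← integral_sum_reward hν h0 h1 α T n k]
  exact integral_mono (integrable_sum_reward hν h0 h1 α T n k)
    (integrable_iSup_sum_reward hν h0 h1 α T n)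
    fun h => le_ciSup (f := fun j => ∑ t, (h t).1 j) (Set.finite_range _).bddAbove k

/-- The arm is drawn independently of the current rewards, so the mean gain of a round is the mean
of a convex combination of the `μ j`. -/
lemma integral_gain_le (hν : HasMomentBound ν μ M) (h0 : 0 ≤ γ) (h1 : γ ≤ 1) (α : ℝ)
    (T n : ℕ) (t : Fin n) : ∫ h, (h t).gain ∂(law ν γ α T n) ≤ ⨆ k, μ k := by
  induction n with
  | zero => exact t.elim0
  | succ n ih =>
    have := isProbabilityMeasure_law hν.isProbabilityMeasure h0 h1 α T n
    induction t using Fin.lastCases with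
    | cast t =>
      exact (integral_comp_init hν.isProbabilityMeasure h0 h1 α T n
        (integrable_gain hν h0 h1 α T n t)).trans_le (ih t)
    | last =>
      have hp : ∀ j, Integrable (fun h => prob γ (weight γ α T n h) j) (law ν γ α T n) := by
        intro j
        refine Integrable.of_bound
          (measurable_prob γ (measurable_weight γ α T n) j).aestronglyMeasurable 1
          (Eventually.of_forall fun h => ?_)
        rw [Real.norm_of_nonneg (prob_nonneg h0 h1 (weight_pos γ α T n h) j)]
        exact prob_le_one h0 h1 (weight_pos γ α T n h) j
      have key : ∀ j : Fin K, Integrable (fun h : Fin (n + 1) → Round K =>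
          (h (Fin.last n)).1 j * if j = (h (Fin.last n)).2 then (1 : ℝ) else 0)
          (law ν γ α T (n + 1)) ∧
          ∫ h, (h (Fin.last n)).1 j * (if j = (h (Fin.last n)).2 then (1 : ℝ) else 0)
          ∂(law ν γ α T (n + 1)) = ∫ h, prob γ (weight γ α T n h) j * μ j ∂(law ν γ α T n) := by
        intro j
        refine ⟨?_, ?_⟩
        · simpa using integrable_law_succ hν.isProbabilityMeasure h0 h1 α T n
            (integrable_const (1 : ℝ)) (hν.integrable_reward n j) (fun a => if j = a then 1 else 0)
        · rw [integral_mul_const, ← hν.mean n j]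
          simpa using integral_law_succ hν.isProbabilityMeasure h0 h1 α T n
            (integrable_const (1 : ℝ)) (hν.integrable_reward n j) (fun a => if j = a then 1 else 0)
      simp_rw [gain_eq_sum]
      rw [integral_finsetSum _ fun j _ => (key j).1]
      simp_rw [fun j => (key j).2]
      rw [← integral_finsetSum _ fun j _ => (hp j).mul_const _]
      calc _ ≤ ∫ _, ⨆ k, μ k ∂(law ν γ α T n) := by
            refine integral_mono (integrable_finsetSum _ fun j _ => (hp j).mul_const _)
              (integrable_const _) fun h => ?_
            calc _ ≤ ∑ j, prob γ (weight γ α T n h) j * ⨆ k, μ k :=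
                  Finset.sum_le_sum fun j _ => mul_le_mul_of_nonneg_left
                    (le_ciSup (Set.finite_range μ).bddAbove j)
                    (prob_nonneg h0 h1 (weight_pos γ α T n h) j)
              _ = _ := by rw [← Finset.sum_mul, sum_prob γ (weight_pos γ α T n h), one_mul]
        _ = _ := by simp

lemma pseudoRegret_nonneg (hν : HasMomentBound ν μ M) (h0 : 0 ≤ γ) (h1 : γ ≤ 1)
    (α : ℝ) (T n : ℕ) : 0 ≤ pseudoRegret μ (law ν γ α T n) := by
  rw [pseudoRegret, sub_nonneg]
  refine (Finset.sum_le_sum fun t _ => integral_gain_le hν h0 h1 α T n t).trans_eq ?_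
  simp

/-- The variance of the cumulated rewards of an arm grows at most linearly. -/
lemma integral_sq_sum_centered_le (hν : HasMomentBound ν μ M) (h0 : 0 ≤ γ) (h1 : γ ≤ 1)
    (α : ℝ) (T n : ℕ) (j : Fin K) :
    Integrable (fun h : Fin n → Round K => (∑ t, ((h t).1 j - μ j)) ^ 2) (law ν γ α T n) ∧
      ∫ h, (∑ t, ((h t).1 j - μ j)) ^ 2 ∂(law ν γ α T n) ≤ n * M := by
  induction n with
  | zero => simp
  | succ n ih =>
    obtain ⟨ihi, ihb⟩ := ih
    have hP := hν.isProbabilityMeasure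
    have := isProbabilityMeasure_law hP h0 h1 α T n
    have hcν : Integrable (fun x => x j - μ j) (ν n) :=
      (hν.integrable_reward n j).sub (integrable_const _)
    have hS : Integrable (fun h : Fin n → Round K => 2 * ∑ t, ((h t).1 j - μ j))
        (law ν γ α T n) :=
      (integrable_finsetSum _ fun t _ => (integrable_reward hP h0 h1 α T n t
        (hν.integrable_reward t j)).sub (integrable_const _)).const_mul _
    -- The cross term integrates to zero: the new centered reward has mean zero and is independent
    -- of the history.
    have e : ∀ h : Fin (n + 1) → Round K, (∑ t, ((h t).1 j - μ j)) ^ 2 =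
        (∑ t : Fin n, ((h t.castSucc).1 j - μ j)) ^ 2 +
        (2 * ∑ t : Fin n, ((h t.castSucc).1 j - μ j)) * ((h (Fin.last n)).1 j - μ j) +
        ((h (Fin.last n)).1 j - μ j) ^ 2 := by
      intro h
      rw [Fin.sum_univ_castSucc]
      ring
    have i1 := integrable_comp_init hP h0 h1 α T n ihi
    have i2 := integrable_mul_reward hP h0 h1 α T n hS hcν
    have i3 := integrable_reward hP h0 h1 α T (n + 1) (Fin.last n) (hν.integrable_centered_sq n j)
    simp_rw [e]
    refine ⟨(i1.add i2).add i3, ?_⟩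
    rw [integral_add (i1.fun_add i2) i3, integral_add i1 i2, integral_comp_init hP h0 h1 α T n ihi,
      integral_mul_reward hP h0 h1 α T n hS hcν, hν.integral_centered,
      integral_reward hP h0 h1 α T (n + 1) (Fin.last n) (hν.integrable_centered_sq n j)]
    have := hν.integral_centered_sq_le n j
    simp only [Fin.val_last]
    push_cast
    linarith

lemma expectedRegret_le_pseudoRegret_add (hν : HasMomentBound ν μ M) (h0 : 0 ≤ γ) (h1 : γ ≤ 1)
    (α : ℝ) (T n : ℕ) (hn : 0 < n) :
    expectedRegret (law ν γ α T n) ≤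
      pseudoRegret μ (law ν γ α T n) + K * ((M + 1) / 2 * √n) := by
  have hP := hν.isProbabilityMeasure
  have := isProbabilityMeasure_law hP h0 h1 α T n
  have hs : 0 < √(n : ℝ) := by positivity
  have hs2 : √(n : ℝ) * √n = n := Real.mul_self_sqrt (by positivity)
  have hi : ∀ j : Fin K, Integrable (fun h : Fin n → Round K =>
      ((∑ t, ((h t).1 j - μ j)) ^ 2 / √n + √n) / 2) (law ν γ α T n) := fun j =>
    (((integral_sq_sum_centered_le hν h0 h1 α T n j).1.div_const _).add
      (integrable_const _)).div_const _
  have hb : ∀ j : Fin K, ∫ h, ((∑ t, ((h t).1 j - μ j)) ^ 2 / √n + √n) / 2 ∂(law ν γ α T n) ≤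
      (M + 1) / 2 * √n := by
    intro j
    rw [integral_div, integral_add ((integral_sq_sum_centered_le hν h0 h1 α T n j).1.div_const _)
      (integrable_const _), integral_div]
    have h2 : (∫ h, (∑ t, ((h t).1 j - μ j)) ^ 2 ∂(law ν γ α T n)) / √n ≤ M * √n := by
      rw [div_le_iff₀ hs, mul_assoc, hs2, mul_comm]
      exact (integral_sq_sum_centered_le hν h0 h1 α T n j).2
    simp only [integral_const, probReal_univ, one_smul]
    linarith
  rw [expectedRegret_eq hν h0 h1, pseudoRegret]
  suffices h : ∫ h, ⨆ j, ∑ t, (h t).1 j ∂(law ν γ α T n) ≤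
      n * (⨆ k, μ k) + K * ((M + 1) / 2 * √n) by linarith
  calc _ ≤ ∫ h, (n * (⨆ k, μ k) + ∑ j : Fin K,
        ((∑ t, ((h t).1 j - μ j)) ^ 2 / √n + √n) / 2) ∂(law ν γ α T n) := by
        refine integral_mono (integrable_iSup_sum_reward hν h0 h1 α T n)
          ((integrable_const _).add (integrable_finsetSum _ fun j _ => hi j)) fun h => ?_
        refine ciSup_le fun j => ?_
        have hj : ∑ t, (h t).1 j = n * μ j + ∑ t, ((h t).1 j - μ j) := by
          simp [Finset.sum_sub_distrib]
        have hm : μ j ≤ ⨆ k, μ k := le_ciSup (Set.finite_range μ).bddAbove j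
        have hsingle := Finset.single_le_sum
          (f := fun j => ((∑ t, ((h t).1 j - μ j)) ^ 2 / √n + √n) / 2)
          (fun j _ => by positivity) (Finset.mem_univ j)
        -- AM-GM at the scale `√n` of the standard deviation, so that second moments suffice;
        -- summing over arms dominates the maximum.
        have hamgm : ∀ S : ℝ, S ≤ (S ^ 2 / √n + √n) / 2 := by
          intro S
          have : (S ^ 2 / √n + √n) / 2 - S = (S - √n) ^ 2 / (2 * √n) := by
            field_simp
            ring
          have : 0 ≤ (S - √n) ^ 2 / (2 * √n) := by positivity
          linarith
        rw [hj]
        exact add_le_add (by gcongr) ((hamgm _).trans hsingle)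
    _ ≤ _ := by
        rw [integral_add (integrable_const _) (integrable_finsetSum _ fun j _ => hi j),
          integral_finsetSum _ fun j _ => hi j]
        have := Finset.sum_le_sum fun j (_ : j ∈ Finset.univ) => hb j
        simp only [Finset.sum_const, Finset.card_univ, Fintype.card_fin, nsmul_eq_mul] at this
        simp only [integral_const, probReal_univ, one_smul]
        linarith

end moments

end EXP3P

namespace EXP3P

/-! ### One step of the exponential weights -/

/-- Second-order Taylor remainder, without any restriction on the size of `x`, since unbounded
rewards allow arbitrarily large exponents. -/
lemma exp_le_one_add_add (x : ℝ) : Real.exp x ≤ 1 + (x + x ^ 2 * Real.exp |x|) := by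
  have h := Complex.norm_exp_sub_sum_le_norm_mul_exp (x : ℂ) 2
  have e : Complex.exp x - ∑ m ∈ Finset.range 2, (x : ℂ) ^ m / (m.factorial : ℂ) =
      ((Real.exp x - (1 + x) : ℝ) : ℂ) := by
    simp [Finset.sum_range_succ]
  rw [e, Complex.norm_real, Complex.norm_real, Real.norm_eq_abs, Real.norm_eq_abs, sq_abs] at h
  linarith [le_abs_self (Real.exp x - (1 + x))]

/-- Factor out the total weight and apply `log y ≤ y - 1` to the remaining weighted average of
exponentials. -/
lemma log_sum_mul_exp_le {K : ℕ} [NeZero K] {w : Fin K → ℝ} (hw : ∀ j, 0 < w j) (x : Fin K → ℝ) :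
    Real.log (∑ j, w j * Real.exp (x j)) ≤
      Real.log (∑ j, w j) + ∑ j, w j / (∑ i, w i) * (x j + x j ^ 2 * Real.exp |x j|) := by
  have hW : 0 < ∑ j, w j := Finset.sum_pos (fun j _ => hw j) Finset.univ_nonempty
  have hq : 0 < ∑ j, w j / (∑ i, w i) * Real.exp (x j) :=
    Finset.sum_pos (fun j _ => mul_pos (div_pos (hw j) hW) (Real.exp_pos _)) Finset.univ_nonempty
  have e : ∑ j, w j * Real.exp (x j) = (∑ j, w j) * ∑ j, w j / (∑ i, w i) * Real.exp (x j) := by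
    rw [Finset.mul_sum]
    refine Finset.sum_congr rfl fun j _ => ?_
    field_simp
  rw [e, Real.log_mul hW.ne' hq.ne']
  have h1 := Real.log_le_sub_one_of_pos hq
  have h2 : ∑ j, w j / (∑ i, w i) * Real.exp (x j) ≤
      ∑ j, w j / (∑ i, w i) * (1 + (x j + x j ^ 2 * Real.exp |x j|)) :=
    Finset.sum_le_sum fun j _ =>
      mul_le_mul_of_nonneg_left (exp_le_one_add_add _) (div_pos (hw j) hW).le
  simp_rw [mul_one_add] at h2
  rw [Finset.sum_add_distrib] at h2
  simp only [sum_div_sum_eq_one hw] at h2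
  linarith

/-- Here `ε` indicates that the arm is pulled. If it is not, the exponent is at most `1`. If it is,
the exponent is at most `1 + |r| / 3`, and `momentFun` absorbs both the square and the exponential.
Keeping `ε` on the first term matters: its mean cancels one factor `1 / p`. -/
lemma sq_mul_exp_abs_le {η p b r ε : ℝ} (hη : 0 ≤ η) (hp : 0 < p) (hηp : η ≤ p / 3) (hb : 0 ≤ b)
    (hb3 : b ≤ 3) (hε : ε = 0 ∨ ε = 1) :
    (η * (r / p * ε + b / p)) ^ 2 * Real.exp |η * (r / p * ε + b / p)| ≤
      2 * Real.exp 1 * η ^ 2 * (1 / p ^ 2 * (momentFun r * ε) + b ^ 2 / p ^ 2 * momentFun r) := by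
  have hs : 0 ≤ η / p := by positivity
  have hs3 : η / p ≤ 1 / 3 := by rw [div_le_iff₀ hp]; linarith
  have hm := sq_add_one_le_momentFun r
  have e1 : ∀ y : ℝ, 1 / p ^ 2 * (momentFun r * y) + b ^ 2 / p ^ 2 * momentFun r =
      (momentFun r * y + b ^ 2 * momentFun r) / p ^ 2 := by
    intro y
    field_simp
  have e2 : ∀ y : ℝ, 2 * Real.exp 1 * η ^ 2 * (y / p ^ 2) = 2 * Real.exp 1 * ((η / p) ^ 2 * y) := by
    intro y
    field_simp
  have e3 : η * (r / p * ε + b / p) = η / p * (r * ε + b) := by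
    field_simp
  rw [e1, e2, e3]
  set s := η / p
  have hsb : s * b ≤ 1 := by nlinarith
  rcases hε with rfl | rfl
  · have h1 : s * (r * 0 + b) = s * b := by ring
    have h0 : 0 ≤ s * b := by positivity
    rw [h1, abs_of_nonneg h0]
    calc (s * b) ^ 2 * Real.exp (s * b) ≤ (s * b) ^ 2 * Real.exp 1 := by gcongr
      _ ≤ 2 * Real.exp 1 * (s ^ 2 * (b ^ 2 * 1)) := by
          have : 0 ≤ (s * b) ^ 2 * Real.exp 1 := by positivity
          nlinarith
      _ ≤ 2 * Real.exp 1 * (s ^ 2 * (b ^ 2 * momentFun r)) := by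
          gcongr
          nlinarith
      _ = _ := by ring
  · have h1 : s * (r * 1 + b) = s * (r + b) := by ring
    have h2 : |s * (r + b)| ≤ 1 + |r| / 3 := by
      rw [abs_mul, abs_of_nonneg hs]
      have h3 := abs_add_le r b
      rw [abs_of_nonneg hb] at h3
      have : s * |r + b| ≤ s * (|r| + b) := by gcongr
      have : s * |r| ≤ 1 / 3 * |r| := by gcongr
      linarith
    have h4 : (s * (r + b)) ^ 2 ≤ 2 * (s ^ 2 * (r ^ 2 + b ^ 2)) := by
      nlinarith [mul_nonneg (sq_nonneg s) (sq_nonneg (r - b))]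
    rw [h1]
    calc (s * (r + b)) ^ 2 * Real.exp |s * (r + b)|
        ≤ 2 * (s ^ 2 * (r ^ 2 + b ^ 2)) * Real.exp (1 + |r| / 3) := by gcongr
      _ = 2 * Real.exp 1 * (s ^ 2 * (r ^ 2 * Real.exp (|r| / 3) + b ^ 2 * Real.exp (|r| / 3))) := by
          rw [Real.exp_add]
          ring
      _ ≤ 2 * Real.exp 1 * (s ^ 2 * (momentFun r * 1 + b ^ 2 * momentFun r)) := by
          have hE : 0 < Real.exp (|r| / 3) := Real.exp_pos _
          have m1 : r ^ 2 * Real.exp (|r| / 3) ≤ momentFun r := by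
            unfold momentFun
            nlinarith
          have m2 : Real.exp (|r| / 3) ≤ momentFun r := by
            unfold momentFun
            nlinarith [mul_nonneg (sq_nonneg r) hE.le]
          rw [mul_one]
          gcongr

/-- The exploitation part alone gives `p ≥ (1 - γ) q`. -/
lemma share_div_prob_le {K : ℕ} {γ : ℝ} (h0 : 0 < γ) (h1 : γ < 1) {w : Fin K → ℝ}
    (hw : ∀ j, 0 < w j) (j : Fin K) :
    w j / (∑ i, w i) / prob γ w j ≤ 1 / (1 - γ) := by
  have hK : (0 : ℝ) < K := by exact_mod_cast j.pos
  have hp : 0 < prob γ w j := (by positivity : 0 < γ / K).trans_le (gamma_div_le_prob h1.le hw j)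
  rw [div_le_div_iff₀ hp (by linarith), prob]
  have : 0 < γ / K := by positivity
  linarith

lemma share_nonneg {K : ℕ} {w : Fin K → ℝ} (hw : ∀ j, 0 < w j) (j : Fin K) :
    0 ≤ w j / (∑ i, w i) :=
  div_nonneg (hw j).le (Finset.sum_nonneg fun j _ => (hw j).le)

lemma inv_prob_le {K : ℕ} {γ : ℝ} (h0 : 0 < γ) (h1 : γ < 1) {w : Fin K → ℝ}
    (hw : ∀ j, 0 < w j) (j : Fin K) : 1 / prob γ w j ≤ K / γ := by
  have hK : (0 : ℝ) < K := by exact_mod_cast j.pos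
  have := one_div_le_one_div_of_le (by positivity) (gamma_div_le_prob h1.le hw j)
  rwa [one_div_div] at this

lemma prob_pos {K : ℕ} {γ : ℝ} (h0 : 0 < γ) (h1 : γ < 1) {w : Fin K → ℝ}
    (hw : ∀ j, 0 < w j) (j : Fin K) : 0 < prob γ w j := by
  have hK : (0 : ℝ) < K := by exact_mod_cast j.pos
  exact (by positivity : 0 < γ / K).trans_le (gamma_div_le_prob h1.le hw j)

lemma share_div_prob_sq_le {K : ℕ} {γ : ℝ} (h0 : 0 < γ) (h1 : γ < 1) {w : Fin K → ℝ}
    (hw : ∀ j, 0 < w j) (j : Fin K) :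
    w j / (∑ i, w i) / prob γ w j ^ 2 ≤ K / (γ * (1 - γ)) := by
  have hp := prob_pos h0 h1 hw j
  have hg : 0 < 1 - γ := by linarith
  calc w j / (∑ i, w i) / prob γ w j ^ 2
      = w j / (∑ i, w i) / prob γ w j * (1 / prob γ w j) := by field_simp
    _ ≤ 1 / (1 - γ) * (K / γ) :=
        mul_le_mul (share_div_prob_le h0 h1 hw j) (inv_prob_le h0 h1 hw j) (by positivity)
          (by positivity)
    _ = _ := by field_simp

/-- The growth of the logarithm of the total weight in one round, in excess of the gain. -/
lemma log_sum_update_le {K : ℕ} [NeZero K] {γ b : ℝ} (h0 : 0 < γ) (h1 : γ < 1)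
    (hb : 0 ≤ b) (hb3 : b ≤ 3) {w : Fin K → ℝ} (hw : ∀ j, 0 < w j) (z : Round K) :
    Real.log (∑ j, w j * Real.exp (γ / (3 * K) * (estimate (prob γ w) z j + b / prob γ w j))) -
        γ / (3 * K) * z.gain ≤
      Real.log (∑ j, w j) + ∑ j,
        (γ / (3 * K) * (w j / (∑ i, w i) / prob γ w j - 1) * z.1 j * (if j = z.2 then 1 else 0) +
        2 * Real.exp 1 * (γ / (3 * K)) ^ 2 * (w j / (∑ i, w i) / prob γ w j ^ 2) *
          momentFun (z.1 j) * (if j = z.2 then 1 else 0) +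
        γ / (3 * K) * b * (w j / (∑ i, w i) / prob γ w j) +
        2 * Real.exp 1 * (γ / (3 * K)) ^ 2 * b ^ 2 * (w j / (∑ i, w i) / prob γ w j ^ 2) *
          momentFun (z.1 j)) := by
  have hK : (0 : ℝ) < K := by exact_mod_cast Nat.pos_of_neZero K
  rw [sub_le_iff_le_add]
  refine (log_sum_mul_exp_le hw _).trans ?_
  rw [add_assoc]
  refine add_le_add_right ?_ _
  rw [gain_eq_sum, Finset.mul_sum, ← Finset.sum_add_distrib]
  refine Finset.sum_le_sum fun j _ => ?_
  have hp := prob_pos h0 h1 hw j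
  -- Uniform exploration gives `p ≥ γ / K`; the factor `3` in the learning rate yields the `1 / 3`
  -- inside `momentFun`.
  have hηp : γ / (3 * K) ≤ prob γ w j / 3 := by
    have := gamma_div_le_prob h1.le hw j
    have e : γ / (3 * K) = γ / K / 3 := by field_simp
    rw [e]
    linarith
  have hest : estimate (prob γ w) z j = z.1 j / prob γ w j * (if j = z.2 then 1 else 0) := by
    simp [estimate]
  have hε : (if j = z.2 then (1 : ℝ) else 0) = 0 ∨ (if j = z.2 then (1 : ℝ) else 0) = 1 := by
    split_ifs <;> simp
  rw [hest]
  generalize (if j = z.2 then (1 : ℝ) else 0) = ε at hε ⊢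
  have hq := share_nonneg hw j
  set q := w j / ∑ i, w i
  set p := prob γ w j
  set η := γ / (3 * K)
  have key := sq_mul_exp_abs_le (r := z.1 j) (by positivity : 0 ≤ η) hp hηp hb hb3 hε
  calc _ ≤ q * (η * (z.1 j / p * ε + b / p) + 2 * Real.exp 1 * η ^ 2 *
        (1 / p ^ 2 * (momentFun (z.1 j) * ε) + b ^ 2 / p ^ 2 * momentFun (z.1 j))) := by
        gcongr
    _ = _ := by
        field_simp
        ring

/-! ### The potential argument -/

lemma measurable_share {K : ℕ} (γ α : ℝ) (T n : ℕ) (j : Fin K) :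
    Measurable fun h : Fin n → Round K =>
      weight γ α T n h j / ∑ i, weight γ α T n h i :=
  (measurable_weight γ α T n j).div
    (Finset.measurable_sum _ fun i _ => measurable_weight γ α T n i)

/-- The error term of one round in the regret analysis. -/
noncomputable def roundError (K : ℕ) (γ b M : ℝ) : ℝ :=
  2 * (γ / (3 * K)) * γ * M +
    K * ((2 * Real.exp 1 * (γ / (3 * K)) ^ 2 * M + γ / (3 * K) * b) * (1 / (1 - γ)) +
      2 * Real.exp 1 * (γ / (3 * K)) ^ 2 * b ^ 2 * M * (K / (γ * (1 - γ))))

section regret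

variable {K : ℕ} [NeZero K] {ν : ℕ → Measure (Fin K → ℝ)} {μ : Fin K → ℝ} {M γ : ℝ}

lemma integrable_share_div_prob (hν : HasMomentBound ν μ M) (h0 : 0 < γ) (h1 : γ < 1) (α : ℝ)
    (T n : ℕ) (j : Fin K) :
    Integrable (fun h => weight γ α T n h j / (∑ i, weight γ α T n h i) /
      prob γ (weight γ α T n h) j) (law ν γ α T n) := by
  have := isProbabilityMeasure_law hν.isProbabilityMeasure h0.le h1.le α T n
  refine Integrable.of_bound ((measurable_share γ α T n j).div
    (measurable_prob γ (measurable_weight γ α T n) j)).aestronglyMeasurable (1 / (1 - γ))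
    (Eventually.of_forall fun h => ?_)
  have hw := weight_pos γ α T n h
  rw [Real.norm_of_nonneg (div_nonneg (share_nonneg hw j) (prob_pos h0 h1 hw j).le)]
  exact share_div_prob_le h0 h1 hw j

lemma integrable_share_div_prob_sq (hν : HasMomentBound ν μ M) (h0 : 0 < γ) (h1 : γ < 1) (α : ℝ)
    (T n : ℕ) (j : Fin K) :
    Integrable (fun h => weight γ α T n h j / (∑ i, weight γ α T n h i) /
      prob γ (weight γ α T n h) j ^ 2) (law ν γ α T n) := by
  have := isProbabilityMeasure_law hν.isProbabilityMeasure h0.le h1.le α T n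
  refine Integrable.of_bound ((measurable_share γ α T n j).div
    ((measurable_prob γ (measurable_weight γ α T n) j).pow_const 2)).aestronglyMeasurable
    (K / (γ * (1 - γ))) (Eventually.of_forall fun h => ?_)
  have hw := weight_pos γ α T n h
  rw [Real.norm_of_nonneg (div_nonneg (share_nonneg hw j) (sq_nonneg _))]
  exact share_div_prob_sq_le h0 h1 hw j

lemma integrable_inv_prob (hν : HasMomentBound ν μ M) (h0 : 0 < γ) (h1 : γ < 1) (α : ℝ)
    (T n : ℕ) (j : Fin K) :
    Integrable (fun h => 1 / prob γ (weight γ α T n h) j) (law ν γ α T n) := by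
  have := isProbabilityMeasure_law hν.isProbabilityMeasure h0.le h1.le α T n
  refine Integrable.of_bound (measurable_const.div
    (measurable_prob γ (measurable_weight γ α T n) j)).aestronglyMeasurable
    (K / γ) (Eventually.of_forall fun h => ?_)
  have hw := weight_pos γ α T n h
  rw [Real.norm_of_nonneg (one_div_nonneg.2 (prob_pos h0 h1 hw j).le)]
  exact inv_prob_le h0 h1 hw j

/-- This is the one-round bound of `log_sum_update_le` after averaging: arm indicators become `p j`,
rewards become `μ j`, and their moments become `m j`. -/
lemma expected_growth_le (hν : HasMomentBound ν μ M) (h0 : 0 < γ) (h1 : γ < 1)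
    {b : ℝ} (hb : 0 ≤ b) {w : Fin K → ℝ} (hw : ∀ j, 0 < w j)
    {m : Fin K → ℝ} (hm0 : ∀ j, 0 ≤ m j) (hm : ∀ j, m j ≤ M) :
    ∑ j, (γ / (3 * K) * (w j / (∑ i, w i) / prob γ w j - 1) * prob γ w j * μ j +
        2 * Real.exp 1 * (γ / (3 * K)) ^ 2 * (w j / (∑ i, w i) / prob γ w j ^ 2) *
          prob γ w j * m j +
        γ / (3 * K) * b * (w j / (∑ i, w i) / prob γ w j) +
        2 * Real.exp 1 * (γ / (3 * K)) ^ 2 * b ^ 2 * (w j / (∑ i, w i) / prob γ w j ^ 2) * m j) ≤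
      roundError K γ b M := by
  have hK : (0 : ℝ) < K := by exact_mod_cast Nat.pos_of_neZero K
  calc _ ≤ ∑ j, (γ / (3 * K) * γ * M * (w j / (∑ i, w i) + 1 / K) +
        ((2 * Real.exp 1 * (γ / (3 * K)) ^ 2 * M + γ / (3 * K) * b) * (1 / (1 - γ)) +
        2 * Real.exp 1 * (γ / (3 * K)) ^ 2 * b ^ 2 * M * (K / (γ * (1 - γ))))) := by
        refine Finset.sum_le_sum fun j _ => ?_
        have hp := prob_pos h0 h1 hw j
        have hq := share_nonneg hw j
        have hqp := share_div_prob_le h0 h1 hw j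
        have hqp2 := share_div_prob_sq_le h0 h1 hw j
        -- Sampling differs from the exponential weights only by the uniform mixture, so the
        -- first-order bias carries a factor `γ`.
        have hdiff : w j / (∑ i, w i) - prob γ w j = γ * (w j / (∑ i, w i) - 1 / K) := by
          unfold prob
          ring
        have hμ := abs_le.1 (hν.abs_mean_le j)
        have hmj := hm j
        have hm0j := hm0 j
        have hM : 0 ≤ M := hm0j.trans hmj
        set q := w j / ∑ i, w i
        set p := prob γ w j
        set η := γ / (3 * K)
        have hη : 0 ≤ η := by positivity
        have e1 : η * (q / p - 1) * p * μ j = η * γ * ((q - 1 / K) * μ j) := by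
          have : (q / p - 1) * p = q - p := by field_simp
          rw [mul_assoc η, this, hdiff]
          ring
        have e2 : 2 * Real.exp 1 * η ^ 2 * (q / p ^ 2) * p * m j =
            2 * Real.exp 1 * η ^ 2 * (m j * (q / p)) := by
          field_simp
        have b1 : (q - 1 / K) * μ j ≤ M * (q + 1 / K) := by
          have : 0 ≤ 1 / (K : ℝ) := by positivity
          nlinarith
        have b2 : m j * (q / p) ≤ M * (1 / (1 - γ)) :=
          mul_le_mul hmj hqp (by positivity) hM
        have b4 : q / p ^ 2 * m j ≤ K / (γ * (1 - γ)) * M :=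
          mul_le_mul hqp2 hmj hm0j (le_trans (by positivity) hqp2)
        rw [e1, e2]
        calc _ ≤ η * γ * (M * (q + 1 / K)) + 2 * Real.exp 1 * η ^ 2 * (M * (1 / (1 - γ))) +
              η * b * (1 / (1 - γ)) +
              2 * Real.exp 1 * η ^ 2 * b ^ 2 * (K / (γ * (1 - γ)) * M) := by
              rw [mul_assoc _ (q / p ^ 2) (m j)]
              gcongr
          _ = _ := by ring
    _ = _ := by
        rw [Finset.sum_add_distrib, ← Finset.mul_sum, Finset.sum_add_distrib,
          sum_div_sum_eq_one hw]
        simp only [Finset.sum_const, Finset.card_univ, Fintype.card_fin, nsmul_eq_mul]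
        rw [mul_one_div_cancel hK.ne']
        unfold roundError
        ring

/-- An integrable majorant `V` is carried along instead of the potential itself, so the
integrability of the logarithm of the total weight is never needed. Each round adds to `V` the
explicit upper bound from `log_sum_update_le`. -/
lemma exists_potential_bound (hν : HasMomentBound ν μ M) (h0 : 0 < γ) (h1 : γ < 1) {α : ℝ}
    {T : ℕ} (hα : 0 ≤ α) (hα3 : α / √(K * T) ≤ 3) (n : ℕ) :
    ∃ V : (Fin n → Round K) → ℝ, Integrable V (law ν γ α T n) ∧
      (∀ h, Real.log (∑ j, weight γ α T n h j) - γ / (3 * K) * ∑ t, (h t).gain ≤ V h) ∧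
      ∫ h, V h ∂(law ν γ α T n) ≤
        α * γ / 3 * √(T / K) + Real.log K + n * roundError K γ (α / √(K * T)) M := by
  have hK : (0 : ℝ) < K := by exact_mod_cast Nat.pos_of_neZero K
  have hP := hν.isProbabilityMeasure
  induction n with
  | zero =>
    have := isProbabilityMeasure_law hP h0.le h1.le α T 0
    refine ⟨fun _ => α * γ / 3 * √(T / K) + Real.log K, integrable_const _, fun h => ?_, ?_⟩
    · simp only [weight, Finset.sum_const, Finset.card_univ, Fintype.card_fin, nsmul_eq_mul]
      rw [Real.log_mul hK.ne' (Real.exp_pos _).ne', Real.log_exp]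
      simp [add_comm]
    · simp
  | succ n ih =>
    obtain ⟨V, hVi, hV, hVb⟩ := ih
    have := isProbabilityMeasure_law hP h0.le h1.le α T n
    set b := α / √(K * T)
    have hb : 0 ≤ b := by positivity
    set η := γ / (3 * K)
    let q : (Fin n → Round K) → Fin K → ℝ :=
      fun h j => weight γ α T n h j / ∑ i, weight γ α T n h i
    let p : (Fin n → Round K) → Fin K → ℝ := fun h => prob γ (weight γ α T n h)
    let u : Fin K → Fin K → ℝ := fun j a => if j = a then 1 else 0
    have hu : ∀ h j, ∑ i, p h i * u j i = p h j := by
      intro h j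
      simp [u]
    have hq1 : ∀ j, Integrable (fun h => q h j / p h j) (law ν γ α T n) :=
      integrable_share_div_prob hν h0 h1 α T n
    have hq2 : ∀ j, Integrable (fun h => q h j / p h j ^ 2) (law ν γ α T n) :=
      integrable_share_div_prob_sq hν h0 h1 α T n
    have hc1 : ∀ j, Integrable (fun h => η * (q h j / p h j - 1)) (law ν γ α T n) := fun j =>
      ((hq1 j).sub (integrable_const _)).const_mul _
    have hc2 : ∀ j, Integrable (fun h => 2 * Real.exp 1 * η ^ 2 * (q h j / p h j ^ 2))
        (law ν γ α T n) := fun j => (hq2 j).const_mul _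
    have hc3 : ∀ j, Integrable (fun h => η * b * (q h j / p h j)) (law ν γ α T n) := fun j =>
      (hq1 j).const_mul _
    have hc4 : ∀ j, Integrable (fun h => 2 * Real.exp 1 * η ^ 2 * b ^ 2 * (q h j / p h j ^ 2))
        (law ν γ α T n) := fun j => (hq2 j).const_mul _
    have i1 := fun j => integrable_law_succ hP h0.le h1.le α T n (hc1 j)
      (hν.integrable_reward n j) (u j)
    have i2 := fun j => integrable_law_succ hP h0.le h1.le α T n (hc2 j) (hν.integrable n j) (u j)
    have i3 := fun j => integrable_comp_init hP h0.le h1.le α T n (hc3 j)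
    have i4 := fun j => integrable_mul_reward hP h0.le h1.le α T n (hc4 j) (hν.integrable n j)
    have hpb : ∀ (c : (Fin n → Round K) → ℝ) (j : Fin K), Integrable c (law ν γ α T n) →
        Integrable (fun h => c h * p h j) (law ν γ α T n) := by
      intro c j hc
      refine hc.mul_bdd (c := 1)
        (measurable_prob γ (measurable_weight γ α T n) j).aestronglyMeasurable
        (Eventually.of_forall fun h => ?_)
      rw [Real.norm_of_nonneg (prob_nonneg h0.le h1.le (weight_pos γ α T n h) j)]
      exact prob_le_one h0.le h1.le (weight_pos γ α T n h) j
    have iY := integrable_finsetSum Finset.univ fun j _ =>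
      (((i1 j).fun_add (i2 j)).fun_add (i3 j)).fun_add (i4 j)
    refine ⟨_, (integrable_comp_init hP h0.le h1.le α T n hVi).fun_add iY, fun h => ?_, ?_⟩
    · have hstep := log_sum_update_le h0 h1 hb hα3
        (weight_pos γ α T n fun i => h i.castSucc) (h (Fin.last n))
      have hVh := hV fun i => h i.castSucc
      have e : ∀ j, weight γ α T (n + 1) h j = weight γ α T n (fun i => h i.castSucc) j *
          Real.exp (η * (estimate (prob γ (weight γ α T n fun i => h i.castSucc))
            (h (Fin.last n)) j + b / prob γ (weight γ α T n fun i => h i.castSucc) j)) := by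
        intro j
        simp only [weight, η, b]
        rw [div_div, mul_comm (√(K * T))]
      simp_rw [e]
      rw [Fin.sum_univ_castSucc, mul_add]
      simp only [u, q, p]
      linarith
    · rw [integral_add (integrable_comp_init hP h0.le h1.le α T n hVi) iY,
        integral_comp_init hP h0.le h1.le α T n hVi]
      have hY : ∀ j, ∫ h, ((fun h => η * (q h j / p h j - 1)) (fun i => h (Fin.castSucc i)) *
          (h (Fin.last n)).1 j * u j (h (Fin.last n)).2 +
          (fun h => 2 * Real.exp 1 * η ^ 2 * (q h j / p h j ^ 2)) (fun i => h (Fin.castSucc i)) *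
            momentFun ((h (Fin.last n)).1 j) * u j (h (Fin.last n)).2 +
          (fun h => η * b * (q h j / p h j)) (fun i => h (Fin.castSucc i)) +
          (fun h => 2 * Real.exp 1 * η ^ 2 * b ^ 2 * (q h j / p h j ^ 2))
            (fun i => h (Fin.castSucc i)) * momentFun ((h (Fin.last n)).1 j))
            ∂(law ν γ α T (n + 1)) =
          ∫ h, (η * (q h j / p h j - 1) * p h j * μ j +
            2 * Real.exp 1 * η ^ 2 * (q h j / p h j ^ 2) * p h j *
              ∫ x, momentFun (x j) ∂(ν n) +
            η * b * (q h j / p h j) +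
            2 * Real.exp 1 * η ^ 2 * b ^ 2 * (q h j / p h j ^ 2) *
              ∫ x, momentFun (x j) ∂(ν n)) ∂(law ν γ α T n) := by
        intro j
        rw [integral_add (((i1 j).fun_add (i2 j)).fun_add (i3 j)) (i4 j),
          integral_add ((i1 j).fun_add (i2 j)) (i3 j), integral_add (i1 j) (i2 j),
          integral_law_succ hP h0.le h1.le α T n (hc1 j) (hν.integrable_reward n j) (u j),
          integral_law_succ hP h0.le h1.le α T n (hc2 j) (hν.integrable n j) (u j),
          integral_comp_init hP h0.le h1.le α T n (hc3 j),
          integral_mul_reward hP h0.le h1.le α T n (hc4 j) (hν.integrable n j), hν.mean]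
        have j1 := (hpb _ j (hc1 j)).mul_const (μ j)
        have j2 := (hpb _ j (hc2 j)).mul_const (∫ x, momentFun (x j) ∂(ν n))
        have j4 := (hc4 j).mul_const (∫ x, momentFun (x j) ∂(ν n))
        rw [integral_add ((j1.fun_add j2).fun_add (hc3 j)) j4,
          integral_add (j1.fun_add j2) (hc3 j), integral_add j1 j2]
        simp_rw [integral_mul_const]
        change (∫ h, _ * ∑ i, p h i * u j i ∂_) * _ + (∫ h, _ * ∑ i, p h i * u j i ∂_) * _ + _ + _
          = _
        simp_rw [hu]
      have jY : ∀ j, Integrable (fun h => η * (q h j / p h j - 1) * p h j * μ j +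
            2 * Real.exp 1 * η ^ 2 * (q h j / p h j ^ 2) * p h j *
              ∫ x, momentFun (x j) ∂(ν n) +
            η * b * (q h j / p h j) +
            2 * Real.exp 1 * η ^ 2 * b ^ 2 * (q h j / p h j ^ 2) *
              ∫ x, momentFun (x j) ∂(ν n)) (law ν γ α T n) := fun j =>
        ((((hpb _ j (hc1 j)).mul_const _).add ((hpb _ j (hc2 j)).mul_const _)).add (hc3 j)).add
          ((hc4 j).mul_const _)
      rw [integral_finsetSum _ fun j _ => (((i1 j).fun_add (i2 j)).fun_add (i3 j)).fun_add (i4 j),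
        Finset.sum_congr rfl fun j _ => hY j, ← integral_finsetSum _ fun j _ => jY j]
      have hle := integral_mono (integrable_finsetSum Finset.univ fun j _ => jY j)
        (integrable_const (roundError K γ b M)) fun h => expected_growth_le hν h0 h1 hb
          (weight_pos γ α T n h) (fun j => integral_nonneg fun x => momentFun_nonneg (x j))
          (fun j => hν.integral_le n j)
      simp only [integral_const, probReal_univ, one_smul] at hle
      push_cast
      linarith

lemma log_weight_lower_bound (hν : HasMomentBound ν μ M) (h0 : 0 < γ) (h1 : γ < 1) {α : ℝ}
    {T : ℕ} (hα : 0 ≤ α) (n : ℕ) (k : Fin K) :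
    Integrable (fun h => Real.log (weight γ α T n h k)) (law ν γ α T n) ∧
      α * γ / 3 * √(T / K) + n * (γ / (3 * K) * μ k) ≤
        ∫ h, Real.log (weight γ α T n h k) ∂(law ν γ α T n) := by
  have hK : (0 : ℝ) < K := by exact_mod_cast Nat.pos_of_neZero K
  have hP := hν.isProbabilityMeasure
  induction n with
  | zero =>
    have := isProbabilityMeasure_law hP h0.le h1.le α T 0
    simp [weight]
  | succ n ih =>
    obtain ⟨ihi, ihb⟩ := ih
    have := isProbabilityMeasure_law hP h0.le h1.le α T n
    have hp := integrable_inv_prob hν h0 h1 α T n k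
    have hc1 := hp.const_mul (γ / (3 * K))
    have hc2 := hp.const_mul (γ / (3 * K) * (α / √(K * T)))
    have e : ∀ h : Fin (n + 1) → Round K, Real.log (weight γ α T (n + 1) h k) =
        Real.log (weight γ α T n (fun i => h i.castSucc) k) +
        γ / (3 * K) * (1 / prob γ (weight γ α T n fun i => h i.castSucc) k) *
          (h (Fin.last n)).1 k * (if k = (h (Fin.last n)).2 then 1 else 0) +
        γ / (3 * K) * (α / √(K * T)) *
          (1 / prob γ (weight γ α T n fun i => h i.castSucc) k) := by
      intro h
      simp only [weight]
      rw [Real.log_mul (weight_pos γ α T n _ k).ne' (Real.exp_pos _).ne', Real.log_exp, add_assoc]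
      congr 1
      have : estimate (prob γ (weight γ α T n fun i => h i.castSucc)) (h (Fin.last n)) k =
          1 / prob γ (weight γ α T n fun i => h i.castSucc) k * (h (Fin.last n)).1 k *
            (if k = (h (Fin.last n)).2 then 1 else 0) := by
        simp [estimate, div_eq_inv_mul]
      rw [this]
      ring
    have i0 := integrable_comp_init hP h0.le h1.le α T n ihi
    have i1 := integrable_law_succ hP h0.le h1.le α T n hc1
      (hν.integrable_reward n k) (fun a => if k = a then 1 else 0)
    have i2 := integrable_comp_init hP h0.le h1.le α T n hc2
    simp_rw [e]
    refine ⟨(i0.add i1).add i2, ?_⟩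
    rw [integral_add (i0.fun_add i1) i2, integral_add i0 i1,
      integral_comp_init hP h0.le h1.le α T n ihi, integral_comp_init hP h0.le h1.le α T n hc2,
      integral_law_succ hP h0.le h1.le α T n hc1 (hν.integrable_reward n k)
        (fun a => if k = a then 1 else 0), hν.mean]
    -- Unbiasedness of the reward estimate: the probability of pulling arm `k` cancels the
    -- importance weight.
    have hone : ∀ h : Fin n → Round K, γ / (3 * K) * (1 / prob γ (weight γ α T n h) k) *
        ∑ i, prob γ (weight γ α T n h) i * (if k = i then 1 else 0) = γ / (3 * K) := by
      intro h
      have := (prob_pos h0 h1 (weight_pos γ α T n h) k).ne'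
      simp [this]
    simp_rw [hone]
    -- The bonus only raises the weight, so it can be dropped from the lower bound.
    have hnn : 0 ≤ ∫ h, γ / (3 * K) * (α / √(K * T)) * (1 / prob γ (weight γ α T n h) k)
        ∂(law ν γ α T n) := integral_nonneg fun h => by
      have := prob_pos h0 h1 (weight_pos γ α T n h) k
      positivity
    simp only [integral_const, probReal_univ, one_smul]
    push_cast
    linarith

/-- One weight is at most the total weight. Take expectations for a best arm; the initial log-weight
occurs on both sides and cancels, leaving `log K` and the round errors, divided by the learning
rate. -/
lemma pseudoRegret_le (hν : HasMomentBound ν μ M) (h0 : 0 < γ) (h1 : γ < 1) {α : ℝ}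
    {T : ℕ} (hα : 0 ≤ α) (hα3 : α / √(K * T) ≤ 3) (n : ℕ) :
    pseudoRegret μ (law ν γ α T n) ≤
      (Real.log K + n * roundError K γ (α / √(K * T)) M) / (γ / (3 * K)) := by
  have hK : (0 : ℝ) < K := by exact_mod_cast Nat.pos_of_neZero K
  obtain ⟨k, hk⟩ := exists_eq_ciSup_of_finite (f := μ)
  obtain ⟨V, hVi, hV, hVb⟩ := exists_potential_bound hν h0 h1 hα hα3 n
  obtain ⟨hwi, hwb⟩ := log_weight_lower_bound (T := T) hν h0 h1 hα n k
  have hg := integrable_finsetSum Finset.univ fun t _ => integrable_gain hν h0.le h1.le α T n t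
  have hle : ∫ h, Real.log (weight γ α T n h k) ∂(law ν γ α T n) ≤
      ∫ h, (V h + γ / (3 * K) * ∑ t, (h t).gain) ∂(law ν γ α T n) := by
    refine integral_mono hwi (hVi.add (hg.const_mul _)) fun h => ?_
    have hlog : Real.log (weight γ α T n h k) ≤ Real.log (∑ j, weight γ α T n h j) :=
      Real.log_le_log (weight_pos γ α T n h k)
        (Finset.single_le_sum (fun j _ => (weight_pos γ α T n h j).le) (Finset.mem_univ k))
    have := hV h
    change _ ≤ V h + _
    linarith
  rw [integral_add hVi (hg.const_mul _), integral_const_mul,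
    integral_finsetSum _ fun t _ => integrable_gain hν h0.le h1.le α T n t] at hle
  rw [pseudoRegret, ← hk, le_div_iff₀ (by positivity)]
  linarith

end regret

end EXP3P

namespace EXP3P

/-! ### The choice of the parameters -/

lemma gammaParam_eq (K T : ℕ) : gammaParam K T = 2 * √(3 * K * Real.log K / 5) / √T := by
  rw [gammaParam, ← div_div, Real.sqrt_div' _ (by positivity)]
  ring

lemma gammaParam_pos {K T : ℕ} (hK : 2 ≤ K) (hT : 1 ≤ T) : 0 < gammaParam K T := by
  have : 0 < Real.log K := Real.log_pos (by exact_mod_cast hK)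
  have : (0 : ℝ) < K := by positivity
  have : (0 : ℝ) < T := by exact_mod_cast hT
  unfold gammaParam
  positivity

lemma tendsto_gammaParam (K : ℕ) : Tendsto (gammaParam K) atTop (nhds 0) := by
  have : gammaParam K = fun T : ℕ => 2 * √(3 * K * Real.log K / 5) / √T :=
    funext fun T => gammaParam_eq K T
  rw [this]
  exact (Real.tendsto_sqrt_atTop.comp tendsto_natCast_atTop_atTop).const_div_atTop _

lemma alphaParam_sq {K T : ℕ} (hK : 2 ≤ K) (hT : 1 ≤ T) {δ : ℝ} (hδ : 0 < δ) (hδ1 : δ < 1) :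
    alphaParam K T δ ^ 2 = 4 * (Real.log K + Real.log T + Real.log (1 / δ)) := by
  have hK' : (1 : ℝ) ≤ K := by exact_mod_cast (by omega : 1 ≤ K)
  have hT' : (1 : ℝ) ≤ T := by exact_mod_cast hT
  have e : Real.log (K * T / δ) = Real.log K + Real.log T + Real.log (1 / δ) := by
    rw [div_eq_mul_one_div, Real.log_mul (by positivity) (by positivity),
      Real.log_mul (by positivity) (by positivity)]
  -- Ensures that the real square root in `alphaParam` is not truncated at zero.
  have hlog : 0 ≤ Real.log (K * T / δ) := by
    refine Real.log_nonneg ?_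
    rw [le_div_iff₀ hδ]
    nlinarith
  rw [alphaParam, mul_pow, Real.sq_sqrt hlog, e]
  norm_num

lemma alphaParam_nonneg (K T : ℕ) (δ : ℝ) : 0 ≤ alphaParam K T δ := by
  unfold alphaParam
  positivity

/-- With `s = √T`, the bound splits into terms of sizes `s`, `s α` and `α²`, all dominated by `s (1
+ α²)`; the assumption `γ ≤ 1/2` replaces `1 / (1 - γ)` by `2`. -/
lemma sum_roundError_le {K : ℕ} (hK : 0 < K) {γ α M g s T : ℝ} (hM : 0 ≤ M) (hg : 0 < g)
    (hs : 1 ≤ s) (hT : T = s ^ 2) (hγ : γ = g / s) (hγ2 : γ ≤ 1 / 2) :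
    (Real.log K + T * roundError K γ (α / (√K * s)) M) / (γ / (3 * K)) ≤
      (3 * K * Real.log K / g + 2 * g * M + 2 * K * (2 * Real.exp 1 * (g / (3 * K)) * M + 1 / √K +
        2 * Real.exp 1 * M / (3 * K))) * (s * (1 + α ^ 2)) := by
  have hK' : (0 : ℝ) < K := by exact_mod_cast hK
  have hk : 0 < √(K : ℝ) := by positivity
  have hk2 : √(K : ℝ) ^ 2 = K := Real.sq_sqrt hK'.le
  have hs0 : 0 < s := by linarith
  have hγ0 : 0 < γ := by rw [hγ]; positivity
  have hγ1 : 0 < 1 - γ := by linarith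
  have hinv : 1 / (1 - γ) ≤ 2 := by
    rw [div_le_iff₀ hγ1]
    linarith
  have hlogK : 0 ≤ Real.log K := Real.log_natCast_nonneg K
  have e : (Real.log K + T * roundError K γ (α / (√K * s)) M) / (γ / (3 * K)) =
      3 * K * Real.log K / g * s + 2 * g * M * s +
      K * ((2 * Real.exp 1 * (g / (3 * K)) * M * s + 1 / √K * (s * α) +
        2 * Real.exp 1 * M / (3 * K) * α ^ 2) * (1 / (1 - γ))) := by
    have hb2 : (α / (√K * s)) ^ 2 = α ^ 2 / (K * s ^ 2) := by
      rw [div_pow, mul_pow, hk2]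
    unfold roundError
    rw [hb2, hT]
    -- Keeps `1 - γ` opaque while the other occurrences of `γ` become `g / s`.
    generalize hc : 1 - γ = c at hγ1 ⊢
    rw [hγ]
    field_simp
    ring
  have hα1 : α ≤ 1 + α ^ 2 := by nlinarith [sq_nonneg (α - 1)]
  have hA : s ≤ s * (1 + α ^ 2) := le_mul_of_one_le_right hs0.le (by nlinarith [sq_nonneg α])
  have hB : s * α ≤ s * (1 + α ^ 2) := by gcongr
  have hC : α ^ 2 ≤ s * (1 + α ^ 2) := by nlinarith [sq_nonneg α]
  rw [e]
  calc _ ≤ 3 * K * Real.log K / g * (s * (1 + α ^ 2)) + 2 * g * M * (s * (1 + α ^ 2)) +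
      K * ((2 * Real.exp 1 * (g / (3 * K)) * M * (s * (1 + α ^ 2)) +
        1 / √K * (s * (1 + α ^ 2)) +
        2 * Real.exp 1 * M / (3 * K) * (s * (1 + α ^ 2))) * 2) := by
        gcongr
    _ = _ := by ring

lemma abs_expectedRegret_le {K : ℕ} (hK : 2 ≤ K) {ν : ℕ → Measure (Fin K → ℝ)} {μ : Fin K → ℝ}
    {M : ℝ} (hM : 0 < M) (hν : HasMomentBound ν μ M) :
    ∃ C : ℝ, ∀ (T : ℕ) (δ : ℝ), 1 ≤ T → gammaParam K T ≤ 1 / 2 →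
      alphaParam K T δ ^ 2 ≤ 9 * T →
      |expectedRegret (runLaw ν T δ)| ≤ C * (√T * (1 + alphaParam K T δ ^ 2)) := by
  have : NeZero K := ⟨by omega⟩
  have hK' : (0 : ℝ) < K := by positivity
  have hK1 : (1 : ℝ) ≤ K := by exact_mod_cast (by omega : 1 ≤ K)
  have hlog : 0 < Real.log K := Real.log_pos (by exact_mod_cast hK)
  set g := 2 * √(3 * K * Real.log K / 5) with hgdef
  have hg : 0 < g := by positivity
  refine ⟨(3 * K * Real.log K / g + 2 * g * M + 2 * K * (2 * Real.exp 1 * (g / (3 * K)) * M +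
    1 / √K + 2 * Real.exp 1 * M / (3 * K))) + K * ((M + 1) / 2), fun T δ hT hγ2 hα9 => ?_⟩
  have hT' : (1 : ℝ) ≤ T := by exact_mod_cast hT
  have hs : 1 ≤ √(T : ℝ) := Real.one_le_sqrt.2 hT'
  have h0 := gammaParam_pos hK hT
  have h1 : gammaParam K T < 1 := by linarith
  have hα := alphaParam_nonneg K T δ
  have hsqrt : √((K : ℝ) * T) = √K * √T := Real.sqrt_mul hK'.le _
  have hα3 : alphaParam K T δ / √(K * T) ≤ 3 := by
    rw [div_le_iff₀ (by positivity)]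
    refine le_of_sq_le_sq ?_ (by positivity)
    rw [mul_pow, Real.sq_sqrt (by positivity)]
    nlinarith
  have hp := pseudoRegret_le (T := T) hν h0 h1 hα hα3 T
  rw [hsqrt] at hp
  have hb := sum_roundError_le (K := K) (α := alphaParam K T δ) (by omega) (T := T) (s := √T) hM.le
    hg hs
    (Real.sq_sqrt (by linarith)).symm (gammaParam_eq K T) hγ2
  have hlow := (pseudoRegret_nonneg hν h0.le h1.le (alphaParam K T δ) T T).trans
    (pseudoRegret_le_expectedRegret hν h0.le h1.le (alphaParam K T δ) T T)
  have hup := expectedRegret_le_pseudoRegret_add hν h0.le h1.le (alphaParam K T δ) T T hT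
  rw [runLaw, abs_of_nonneg hlow, add_mul]
  have hA : √(T : ℝ) ≤ √T * (1 + alphaParam K T δ ^ 2) :=
    le_mul_of_one_le_right (by positivity) (by nlinarith [sq_nonneg (alphaParam K T δ)])
  have hfluct : K * ((M + 1) / 2 * √(T : ℝ)) ≤
      K * ((M + 1) / 2) * (√T * (1 + alphaParam K T δ ^ 2)) := by
    rw [← mul_assoc]
    gcongr
  linarith

lemma isBigO_alphaParam_sq {K : ℕ} (hK : 2 ≤ K) {δ : ℕ → ℝ} (hδ : ∀ T, 0 < δ T ∧ δ T < 1)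
    (hδlog : IsBigOStar (fun T => Real.log (1 / δ T)) (fun _ => 1)) :
    ∃ k : ℕ, (fun T : ℕ => 1 + alphaParam K T (δ T) ^ 2) =O[atTop]
      fun T : ℕ => Real.log T ^ k := by
  obtain ⟨k, hk⟩ := hδlog
  -- The exponent `k + 1` dominates constants, `log T` and `(log T)^k` alike, even when `k = 0`.
  refine ⟨k + 1, ?_⟩
  have hlogT : Tendsto (fun T : ℕ => Real.log T) atTop atTop :=
    Real.tendsto_log_atTop.comp tendsto_natCast_atTop_atTop
  have hpow : ∀ i ≤ k + 1, (fun T : ℕ => Real.log T ^ i) =O[atTop]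
      fun T : ℕ => Real.log T ^ (k + 1) := by
    intro i hi
    refine IsBigO.of_bound 1 ?_
    filter_upwards [hlogT.eventually_ge_atTop 1] with T hT
    rw [one_mul, Real.norm_of_nonneg (by positivity), Real.norm_of_nonneg (by positivity)]
    exact pow_le_pow_right₀ hT hi
  have hconst : ∀ c : ℝ, (fun _ : ℕ => c) =O[atTop] fun T : ℕ => Real.log T ^ (k + 1) := fun c =>
    (isBigO_const_const c one_ne_zero _).trans (by simpa using hpow 0 (by omega))
  have hδO : (fun T => Real.log (1 / δ T)) =O[atTop] fun T : ℕ => Real.log T ^ (k + 1) := by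
    simp only [mul_one] at hk
    exact hk.trans (hpow k (by omega))
  have h1O : (fun T : ℕ => Real.log T) =O[atTop] fun T : ℕ => Real.log T ^ (k + 1) := by
    simpa using hpow 1 (by omega)
  have hsum := (hconst 1).add ((((hconst (Real.log K)).add h1O).add hδO).const_mul_left 4)
  refine hsum.congr' ?_ EventuallyEq.rfl
  filter_upwards [eventually_ge_atTop 1] with T hT
  rw [alphaParam_sq hK hT (hδ T).1 (hδ T).2]

lemma isLittleO_log_pow_natCast (k : ℕ) :
    (fun T : ℕ => Real.log T ^ k) =o[atTop] fun T : ℕ => (T : ℝ) :=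
  Real.isLittleO_pow_log_id_atTop.comp_tendsto tendsto_natCast_atTop_atTop

end EXP3P

theorem theorem7 (K : ℕ) (hK : 2 ≤ K) (ν : ℕ → Measure (Fin K → ℝ)) (μ : Fin K → ℝ)
    (hν : IsSubGaussianBandit ν μ)
    (δ : ℕ → ℝ) (hδ : ∀ T, 0 < δ T ∧ δ T < 1)
    (hδlog : IsBigOStar (fun T => Real.log (1 / δ T)) (fun _ => 1)) :
    (∀ T : ℕ, 1 ≤ T → EXP3P.gammaParam K T < 1 →
      IsProbabilityMeasure (EXP3P.runLaw ν T (δ T)) ∧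
      (∀ t, Integrable (fun h => (h t).gain) (EXP3P.runLaw ν T (δ T))) ∧
      Integrable regret (EXP3P.runLaw ν T (δ T)) ∧
      pseudoRegret μ (EXP3P.runLaw ν T (δ T)) ≤ expectedRegret (EXP3P.runLaw ν T (δ T))) ∧
    IsBigOStar (fun T => expectedRegret (EXP3P.runLaw ν T (δ T))) (fun T => √T) := by
  have : NeZero K := ⟨by omega⟩
  obtain ⟨M, hM, hMν⟩ := hν.exists_momentBound
  refine ⟨fun T hT h1 => ?_, ?_⟩
  · have h0 := (EXP3P.gammaParam_pos hK hT).le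
    exact ⟨EXP3P.isProbabilityMeasure_law hMν.isProbabilityMeasure h0 h1.le _ _ _,
      EXP3P.integrable_gain hMν h0 h1.le _ _ _, EXP3P.integrable_regret hMν h0 h1.le _ _ _,
      EXP3P.pseudoRegret_le_expectedRegret hMν h0 h1.le _ _ _⟩
  · obtain ⟨C, hC⟩ := EXP3P.abs_expectedRegret_le hK hM hMν
    obtain ⟨k, hk⟩ := EXP3P.isBigO_alphaParam_sq hK hδ hδlog
    refine ⟨k, ?_⟩
    -- A power of `log T` is `o(T)`, so eventually `1 + α² ≤ T`, which gives the condition `α² ≤ 9T`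
    -- behind `b ≤ 3`.
    have hsmall := (hk.trans_isLittleO (EXP3P.isLittleO_log_pow_natCast k)).bound one_pos
    have hbound : (fun T => expectedRegret (EXP3P.runLaw ν T (δ T))) =O[atTop]
        fun T : ℕ => √T * (1 + EXP3P.alphaParam K T (δ T) ^ 2) := by
      refine IsBigO.of_bound C ?_
      filter_upwards [eventually_ge_atTop 1, hsmall,
        (EXP3P.tendsto_gammaParam K).eventually_le_const (by norm_num : (0 : ℝ) < 1 / 2)]
        with T hT hs hγ
      rw [Real.norm_of_nonneg (by positivity), Real.norm_of_nonneg (by positivity)] at hs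
      rw [Real.norm_of_nonneg (by positivity : 0 ≤ √(T : ℝ) * _)]
      have : (0 : ℝ) ≤ T := by positivity
      exact hC T (δ T) hT hγ (by linarith)
    refine hbound.trans ?_
    simp_rw [mul_comm (Real.log _ ^ k)]
    exact (isBigO_refl _ _).mul hk
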